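/- Let $d\ge 1$. Consider distributions of pairs $(X,Y)\in\mathbb R^d\times\{0,1\}$ such that $X$ has a Lebesgue density $\mu$ with $\Omega:=\{\mu>0\}$ open, and put $\eta(x)=\mathbb P(Y=1\mid X=x)$. A classifier based on $n$ observations is a measurable map $\Phi_n$ from $(\mathbb R^d\times\{0,1\})^n\times\mathbb R^d$ to $\{0,1\}$; for an i.i.d. sample $\mathcal S_n$ of size $n$ and an independent copy $(X,Y)$, its risk is $\mathcal R(\Phi_n)=\mathbb P(\Phi_n(\mathcal S_n,X)\ne Y)$. The Bayes classifier is $\Phi^*=\mathbf 1_{\{\eta>1/2\}}$. For $L,\alpha,C,\kappa,\delta_0,\varepsilon_0>0$ consider the following classes of distributions: * $\mathcal F_{L,\alpha,C}$: $|\eta(x)-\eta(y)|\le L|x-y|$ for all $x,y\in\Omega$, and $\mathbb P(0<|\eta(X)-\tfrac12|<\varepsilon)\le C\varepsilon^{\alpha}$ for all $\varepsilon>0$; * $\mathfrak M_{mma}(\kappa,\delta_0)$: $\mathbb P(X\in B(x,\delta))\ge\kappa\,\mu(x)\,\delta^d$ for all $0<\delta\le\delta_0$ and all $x\in\Omega$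 (Euclidean balls); and $\mathfrak M_{mma}(\kappa)=\bigcup_{\delta_0>0}\mathfrak M_{mma}(\kappa,\delta_0)$; * $\mathcal P_{\mathcal T,Id}(\varepsilon_0)$: $\mathbb P(\mu(X)<\varepsilon)\le\varepsilon$ for all $0<\varepsilon<\varepsilon_0$. Let $\gamma_d$ be the Lebesgue measure of the unit Euclidean ball of $\mathbb R^d$. (1) For all $L,\alpha,C,\varepsilon_0>0$ and all $0<\kappa<\gamma_d$ there is a constant $c>0$ such that, for all $n\ge1$, $$\inf_{\Phi_n}\ \sup_{\mathcal F_{L,\alpha,C}\cap\mathfrak M_{mma}(\kappa)\cap\mathcal P_{\mathcal T,Id}(\varepsilon_0)}\big[\mathcal R(\Phi_n)-\mathcal R(\Phi^*)\big]\ \ge\ c\,n^{-\frac{1+\alpha}{2+\alpha+d}} ,$$ where the infimum is over all classifiers based on $n$ observations. (2) There are $\kappa_0,\delta_0>0$ depending only on $d$ such that the bound in (1) holds with $\mathfrak M_{mma}(\kappa)$ replaced by the class $\mathfrak M_{mma}(\kappa_0,\delta_0)$ with a fixed range of radii: for all $L,\alpha,C,\varepsilon_0>0$ there is $c>0$ such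 that for all $n\ge1$ $$\inf_{\Phi_n}\ \sup_{\mathcal F_{L,\alpha,C}\cap\mathfrak M_{mma}(\kappa_0,\delta_0)\cap\mathcal P_{\mathcal T,Id}(\varepsilon_0)}\big[\mathcal R(\Phi_n)-\mathcal R(\Phi^*)\big]\ \ge\ c\,n^{-\frac{1+\alpha}{2+\alpha+d}} .$$ -/

import Mathlib

open MeasureTheory

namespace BinaryClassification

/-- The Euclidean space `ℝ^d`. -/
abbrev E (d : ℕ) : Type := EuclideanSpace ℝ (Fin d)

/-- A distribution of a pair `(X, Y)` on `ℝ^d × {0, 1}` (the label `1` is `true`), given by the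
Lebesgue density of `X`, whose positivity set `Ω` is open, and by the regression function
`η x = P(Y = 1 | X = x)`. -/
structure Model (d : ℕ) where
  density : E d → ℝ
  measurable_density : Measurable density
  density_nonneg : ∀ x, 0 ≤ density x
  lintegral_density : ∫⁻ x, ENNReal.ofReal (density x) = 1
  isOpen_pos : IsOpen {x | 0 < density x}
  regression : E d → ℝ
  measurable_regression : Measurable regression
  regression_mem : ∀ x, regression x ∈ Set.Icc (0 : ℝ) 1

namespace Model

variable {d : ℕ} (M : Model d)

/-- The set `Ω` on which the density lives. -/
def support : Set (E d) := {x | 0 < M.density x}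

/-- The law of `X`. -/
noncomputable def marginal : Measure (E d) :=
  volume.withDensity fun x => ENNReal.ofReal (M.density x)

/-- The law of `(X, Y)`: `X` has law `marginal`, and given `X = x` the label is Bernoulli with
parameter `regression x`. -/
noncomputable def law : Measure (E d × Bool) :=
  (M.marginal.withDensity fun x => ENNReal.ofReal (M.regression x)).map (fun x => (x, true)) +
  (M.marginal.withDensity fun x => ENNReal.ofReal (1 - M.regression x)).map (fun x => (x, false))

instance : IsProbabilityMeasure M.marginal :=
  ⟨by rw [marginal, withDensity_apply _ MeasurableSet.univ, Measure.restrict_univ,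
    M.lintegral_density]⟩

theorem law_prod_true {A : Set (E d)} (hA : MeasurableSet A) :
    M.law (A ×ˢ {true}) = ∫⁻ x in A, ENNReal.ofReal (M.regression x) ∂M.marginal := by
  have hm : MeasurableSet (A ×ˢ ({true} : Set Bool)) := hA.prod (measurableSet_singleton _)
  have h1 : (fun x : E d => (x, true)) ⁻¹' (A ×ˢ ({true} : Set Bool)) = A := by ext; simp
  have h2 : (fun x : E d => (x, false)) ⁻¹' (A ×ˢ ({true} : Set Bool)) = ∅ := by ext; simp
  rw [law, Measure.add_apply, Measure.map_apply (by fun_prop) hm,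
    Measure.map_apply (by fun_prop) hm, h1, h2, measure_empty, add_zero, withDensity_apply _ hA]

theorem law_map_fst : M.law.map Prod.fst = M.marginal := by
  ext A hA
  have hm : MeasurableSet (Prod.fst ⁻¹' A : Set (E d × Bool)) := measurable_fst hA
  have h1 (b : Bool) : (fun x : E d => (x, b)) ⁻¹' (Prod.fst ⁻¹' A) = A := by ext; simp
  rw [Measure.map_apply measurable_fst hA, law, Measure.add_apply,
    Measure.map_apply (by fun_prop) hm, Measure.map_apply (by fun_prop) hm, h1, h1,
    withDensity_apply _ hA, withDensity_apply _ hA,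
    ← lintegral_add_left M.measurable_regression.ennreal_ofReal]
  have h (x : E d) : ENNReal.ofReal (M.regression x) + ENNReal.ofReal (1 - M.regression x) = 1 := by
    rw [← ENNReal.ofReal_add (M.regression_mem x).1 (by linarith [(M.regression_mem x).2])]
    simp
  simp [h]

instance : IsProbabilityMeasure M.law :=
  ⟨by
    have h : M.law.map Prod.fst Set.univ = 1 := by rw [law_map_fst]; exact measure_univ
    rwa [Measure.map_apply measurable_fst MeasurableSet.univ, Set.preimage_univ] at h⟩

open Classical in
/-- The Bayes classifier `1_{η > 1/2}`. -/
noncomputable def bayes (x : E d) : Bool := decide (1 / 2 < M.regression x)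

/-- The misclassification probability of the Bayes classifier. -/
noncomputable def bayesRisk : ℝ := M.law.real {z | M.bayes z.1 ≠ z.2}

end Model

/-- A classifier built on a sample of size `n`: a (jointly) measurable rule that maps the sample
and a new point of `ℝ^d` to a label. -/
structure Classifier (d n : ℕ) where
  rule : (Fin n → E d × Bool) → E d → Bool
  measurable_rule : Measurable fun z : (Fin n → E d × Bool) × E d => rule z.1 z.2

/-- The misclassification probability `P(Φ_n(X) ≠ Y)`, where `(X, Y)` is independent of the i.i.d.
sample `(X_1, Y_1), …, (X_n, Y_n)` on which the classifier is built. -/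
noncomputable def risk {d n : ℕ} (M : Model d) (Φ : Classifier d n) : ℝ :=
  ((Measure.pi fun _ : Fin n => M.law).prod M.law).real {z | Φ.rule z.1 z.2.1 ≠ z.2.2}

/-- The excess risk. -/
noncomputable def excessRisk {d n : ℕ} (M : Model d) (Φ : Classifier d n) : ℝ :=
  risk M Φ - M.bayesRisk

/-- The minimax excess risk over a class of distributions, for samples of size `n`. The extended
reals are used so that suprema and infima have no conventional values. -/
noncomputable def minimaxRisk {d : ℕ} (n : ℕ) (F : Set (Model d)) : EReal :=
  ⨅ Φ : Classifier d n, ⨆ M ∈ F, ((excessRisk M Φ : ℝ) : EReal)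

/-- Smoothness and margin: `η` is `L`-Lipschitz on `Ω`, and
`P(0 < |η(X) - 1/2| < ε) ≤ C ε^α` for all `ε > 0`. -/
def smoothMargin (d : ℕ) (L α C : ℝ) : Set (Model d) :=
  {M | (∀ x ∈ M.support, ∀ y ∈ M.support, |M.regression x - M.regression y| ≤ L * ‖x - y‖) ∧
    ∀ ε : ℝ, 0 < ε →
      M.marginal.real {x | 0 < |M.regression x - 1 / 2| ∧ |M.regression x - 1 / 2| < ε} ≤ C * ε ^ α}

/-- Strong minimal mass with a prescribed range `(0, δ₀]` of radii. -/
def minimalMassUpTo (d : ℕ) (κ δ₀ : ℝ) : Set (Model d) :=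
  {M | ∀ δ : ℝ, 0 < δ → δ ≤ δ₀ → ∀ x ∈ M.support,
    κ * M.density x * δ ^ d ≤ M.marginal.real (Metric.ball x δ)}

/-- Strong minimal mass: the range of radii may depend on the distribution. -/
def minimalMass (d : ℕ) (κ : ℝ) : Set (Model d) :=
  {M | ∃ δ₀ : ℝ, 0 < δ₀ ∧ M ∈ minimalMassUpTo d κ δ₀}

/-- Tail condition driven by `ψ`, with a prescribed range `(0, ε₀)` of levels. -/
def tail (d : ℕ) (ψ : ℝ → ℝ) (ε₀ : ℝ) : Set (Model d) :=
  {M | ∀ ε : ℝ, 0 < ε → ε < ε₀ → M.marginal.real {x | M.density x < ε} ≤ ψ ε}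

end BinaryClassification

/-!
The lower bound is Assouad's argument on a family of distributions whose marginal is supported on
finitely many separated balls.

*The family* (`gridMixture`). Inside a fixed cube stands a grid of `N ^ d` small balls of radius of
order `1 / N`, which together carry a small mass `q`; the remaining mass sits on one ball of fixed
size, far away. On each ball the density is a multiple of `1 - |x - c|² / ρ²`. The regression
function equals `1 / 2` on the large ball and `1 / 2 ± a / N` on the small ones, one sign per ball.

*Membership.* The regression function is constant on each ball and the balls are separated by
gaps of order `1 / N`, so it is Lipschitz on the support. The margin `|η - 1 / 2|` takes only the
values `0` and `a / N`, so the margin condition reduces to `q ≤ C (a / N) ^ α`, which allows `q` of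
order `N ^ (-α)`. The support has volume at most one, which makes the tail condition automatic
(`BallMixture.mem_tail`). The paraboloid profile vanishes at the boundary of its ball slowly enough
for the minimal mass condition: with every constant below the volume of the unit ball for small
radii (`exists_mul_le_setIntegral_profile`), and with a dimensional constant for all radii up to
the diameter (`profileConst_mul_le`). For radii above the mesh of the grid, a ball around a point of
the grid contains a number of cells proportional to its volume
(`gridMixture_mem_minimalMassUpTo`), which gives a range of radii independent of `N`.

*Excess risk.* On a small ball of mass `p = q / N ^ d` the excess risk is `2 a / N` times the
mislabelled mass. Flipping the sign there changes the Hellinger affinity of the two labelled laws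
from `1` to at least `1 - 4 p (a / N)²` (`BallMixture.one_le_affinity_add`). The affinity is
multiplicative over the sample, so as long as `n p / N²` is small, no classifier can decide on the
sign (`affinity_pow_le`, `BallMixture.weight_le_meanMiss_add`). Averaging over all sign patterns,
some pattern has excess risk at least `q a / (4 N)` (`BallMixture.exists_le_excessRisk`). With `q`
of order `N ^ (-α)` the constraint reads `n ≤ N ^ (2 + α + d)`, and the bound becomes a multiple of
`N ^ (-(1 + α))`.
-/

namespace BinaryClassification

open scoped ENNReal NNReal

/-! ### Product measures and the affinity of two samples -/

theorem lintegral_pi_prod {Z : Type*} [MeasurableSpace Z] (μ : Measure Z) [SigmaFinite μ] {n : ℕ}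
    {f : Fin n → Z → ℝ≥0∞} (hf : ∀ i, Measurable (f i)) :
    ∫⁻ z, ∏ i, f i (z i) ∂(Measure.pi fun _ : Fin n => μ) = ∏ i, ∫⁻ z, f i z ∂μ := by
  induction n with
  | zero => simp
  | succ n ih =>
    have e := (measurePreserving_piFinSuccAbove (fun _ : Fin (n + 1) => μ) 0).symm
    rw [← e.lintegral_comp_emb (MeasurableEquiv.measurableEmbedding _)]
    simp_rw [MeasurableEquiv.piFinSuccAbove_symm_apply, Fin.insertNthEquiv, Fin.prod_univ_succ,
      Fin.insertNth_zero, Equiv.coe_fn_mk, Fin.cons_succ, Fin.cons_zero]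
    have hg : Measurable fun z : Fin n → Z => ∏ i : Fin n, f i.succ (z i) :=
      Finset.measurable_prod _ fun i _ => (hf _).comp (measurable_pi_apply i)
    rw [← ih fun i => hf i.succ]
    exact lintegral_prod_mul (hf 0).aemeasurable hg.aemeasurable

theorem pi_withDensity {Z : Type*} [MeasurableSpace Z] (μ : Measure Z) [SigmaFinite μ]
    {f : Z → ℝ≥0∞} (hf : Measurable f) [SigmaFinite (μ.withDensity f)] (n : ℕ) :
    Measure.pi (fun _ : Fin n => μ.withDensity f) =
      (Measure.pi fun _ : Fin n => μ).withDensity fun z => ∏ i, f (z i) := by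
  refine Measure.pi_eq fun s hs => ?_
  rw [withDensity_apply _ (MeasurableSet.univ_pi hs),
    ← lintegral_indicator (MeasurableSet.univ_pi hs)]
  have h (z : Fin n → Z) : (Set.univ.pi s).indicator (fun z => ∏ i, f (z i)) z =
      ∏ i, (s i).indicator f (z i) := by
    by_cases hz : z ∈ Set.univ.pi s
    · rw [Set.indicator_of_mem hz]
      exact Finset.prod_congr rfl fun i _ => (Set.indicator_of_mem (hz i trivial) f).symm
    · rw [Set.indicator_of_notMem hz]
      obtain ⟨i, hi⟩ : ∃ i, z i ∉ s i := by simpa [Set.mem_pi] using hz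
      exact (Finset.prod_eq_zero (Finset.mem_univ i) (Set.indicator_of_notMem hi f)).symm
  simp_rw [h, lintegral_pi_prod μ fun i => hf.indicator (hs i), lintegral_indicator (hs _),
    withDensity_apply _ (hs _)]

/-- A linear lower bound for the minimum in terms of the geometric mean. -/
theorem sqrt_mul_le_min_add (a b : ℝ≥0) :
    NNReal.sqrt (a * b) ≤ min a b + (a + b) / 4 := by
  rw [NNReal.sqrt_le_iff_le_sq]
  rcases le_total a b with h | h
  · rw [min_eq_left h, ← NNReal.coe_le_coe]
    push_cast
    nlinarith [sq_nonneg ((a : ℝ) - b), a.2, b.2, mul_nonneg a.2 b.2, sq_nonneg (3 * (a : ℝ) - b)]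
  · rw [min_eq_right h, ← NNReal.coe_le_coe]
    push_cast
    nlinarith [sq_nonneg ((a : ℝ) - b), a.2, b.2, mul_nonneg a.2 b.2, sq_nonneg (3 * (b : ℝ) - a)]

/-- Two-point lower bound. If the affinity `∫ √(f g)` of two probability densities is `ρ`, then no
pair of loss functions with `a + b ≥ p` has both mean losses small for samples of size `n`: the sum
of the means is at least `p (ρ ^ n - 1 / 2)`. -/
theorem affinity_pow_le {Z : Type*} [MeasurableSpace Z] (Q : Measure Z) [SigmaFinite Q]
    {f g : Z → ℝ≥0} (hf : Measurable f) (hg : Measurable g)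
    [IsProbabilityMeasure (Q.withDensity fun z => (f z : ℝ≥0∞))]
    [IsProbabilityMeasure (Q.withDensity fun z => (g z : ℝ≥0∞))]
    {n : ℕ} {a b : (Fin n → Z) → ℝ≥0∞} (ha : Measurable a) (hb : Measurable b) {p : ℝ≥0∞}
    (hab : ∀ z, p ≤ a z + b z) :
    p * (∫⁻ z, (NNReal.sqrt (f z * g z) : ℝ≥0∞) ∂Q) ^ n ≤
      ∫⁻ z, a z ∂(Measure.pi fun _ : Fin n => Q.withDensity fun z => (f z : ℝ≥0∞)) +
      ∫⁻ z, b z ∂(Measure.pi fun _ : Fin n => Q.withDensity fun z => (g z : ℝ≥0∞)) + p / 2 := by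
  set μ := Measure.pi fun _ : Fin n => Q
  have hF (f : Z → ℝ≥0) (hf : Measurable f) :
      Measurable fun z : Fin n → Z => ∏ i, f (z i) :=
    Finset.measurable_prod _ fun i _ => hf.comp (measurable_pi_apply i)
  have hF' := fun f hf => (hF f hf).coe_nnreal_ennreal
  have hone (f : Z → ℝ≥0) (hf : Measurable f)
      [IsProbabilityMeasure (Q.withDensity fun z => (f z : ℝ≥0∞))] :
      ∫⁻ z, ((∏ i, f (z i) : ℝ≥0) : ℝ≥0∞) ∂μ = 1 := by
    push_cast
    rw [lintegral_pi_prod Q fun _ => hf.coe_nnreal_ennreal]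
    have h : ∫⁻ z, (f z : ℝ≥0∞) ∂Q = 1 := by
      rw [← setLIntegral_univ, ← withDensity_apply _ MeasurableSet.univ, measure_univ]
    simp [h]
  have hmeas := hF' f hf
  have hmeas' := hF' g hg
  rw [pi_withDensity Q hf.coe_nnreal_ennreal, pi_withDensity Q hg.coe_nnreal_ennreal]
  simp_rw [← ENNReal.ofNNReal_finsetProd]
  rw [lintegral_withDensity_eq_lintegral_mul _ hmeas ha,
    lintegral_withDensity_eq_lintegral_mul _ hmeas' hb]
  have hprod : (∫⁻ z, (NNReal.sqrt (f z * g z) : ℝ≥0∞) ∂Q) ^ n =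
      ∫⁻ z, (NNReal.sqrt ((∏ i, f (z i)) * ∏ i, g (z i)) : ℝ≥0∞) ∂μ := by
    have h (z : Fin n → Z) : NNReal.sqrt ((∏ i, f (z i)) * ∏ i, g (z i)) =
        ∏ i, NNReal.sqrt (f (z i) * g (z i)) := by
      rw [← Finset.prod_mul_distrib]
      exact map_prod NNReal.sqrtHom _ _
    simp_rw [h, ENNReal.ofNNReal_finsetProd]
    have hm : Measurable fun z => (NNReal.sqrt (f z * g z) : ℝ≥0∞) :=
      (NNReal.continuous_sqrt.measurable.comp (hf.mul hg)).coe_nnreal_ennreal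
    rw [lintegral_pi_prod Q fun _ => hm]
    simp
  have hsqrt : Measurable fun z : Fin n → Z =>
      (NNReal.sqrt ((∏ i, f (z i)) * ∏ i, g (z i)) : ℝ≥0∞) :=
    (NNReal.continuous_sqrt.measurable.comp ((hF f hf).mul (hF g hg))).coe_nnreal_ennreal
  rw [hprod, ← lintegral_const_mul _ hsqrt]
  have hpt (z : Fin n → Z) : p * (NNReal.sqrt ((∏ i, f (z i)) * ∏ i, g (z i)) : ℝ≥0∞) ≤
      ((∏ i, f (z i) : ℝ≥0) : ℝ≥0∞) * a z + ((∏ i, g (z i) : ℝ≥0) : ℝ≥0∞) * b z +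
      p / 4 * (((∏ i, f (z i) : ℝ≥0) : ℝ≥0∞) + ((∏ i, g (z i) : ℝ≥0) : ℝ≥0∞)) := by
    set F := ∏ i, f (z i)
    set G := ∏ i, g (z i)
    calc p * (NNReal.sqrt (F * G) : ℝ≥0∞) ≤ p * ((min F G + (F + G) / 4 : ℝ≥0) : ℝ≥0∞) := by
          gcongr
          exact_mod_cast sqrt_mul_le_min_add F G
      _ = p * (min F G : ℝ≥0) + p / 4 * (F + G) := by
          rw [ENNReal.coe_add, mul_add, ENNReal.coe_div (by norm_num)]
          push_cast
          simp only [div_eq_mul_inv]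
          ring
      _ ≤ (a z + b z) * (min F G : ℝ≥0) + p / 4 * (F + G) := by gcongr; exact hab z
      _ ≤ _ := by
          gcongr
          rw [add_mul, mul_comm (a z), mul_comm (b z)]
          gcongr
          · exact min_le_left _ _
          · exact min_le_right _ _
  refine (lintegral_mono hpt).trans (le_of_eq ?_)
  have hma : Measurable fun z => ((∏ i, f (z i) : ℝ≥0) : ℝ≥0∞) * a z := hmeas.mul ha
  have hmb : Measurable fun z => ((∏ i, g (z i) : ℝ≥0) : ℝ≥0∞) * b z := hmeas'.mul hb
  have hmab : Measurable fun z => ((∏ i, f (z i) : ℝ≥0) : ℝ≥0∞) * a z +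
      ((∏ i, g (z i) : ℝ≥0) : ℝ≥0∞) * b z := hma.add hmb
  have hmfg : Measurable fun z : Fin n → Z => ((∏ i, f (z i) : ℝ≥0) : ℝ≥0∞) +
      ((∏ i, g (z i) : ℝ≥0) : ℝ≥0∞) := hmeas.add hmeas'
  rw [lintegral_add_left hmab, lintegral_add_left hma, lintegral_const_mul _ hmfg,
    lintegral_add_left hmeas, hone f hf, hone g hg]
  simp only [Pi.mul_apply]
  congr 1
  rw [show (1 + 1 : ℝ≥0∞) = 2 by norm_num, div_eq_mul_inv, div_eq_mul_inv, mul_assoc]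
  congr 1
  rw [show (4 : ℝ≥0∞) = 2 * 2 by norm_num, ENNReal.mul_inv (by simp) (by simp), mul_assoc,
    ENNReal.inv_mul_cancel (by simp) (by simp), mul_one]

variable {d : ℕ}

/-! ### A paraboloid profile on a ball -/

/-- The function `1 - |x - c|² / ρ²` on the ball of centre `c` and radius `ρ`, extended by zero. -/
noncomputable def profile (c : E d) (ρ : ℝ) (x : E d) : ℝ :=
  max 0 (1 - ‖x - c‖ ^ 2 / ρ ^ 2)

theorem profile_nonneg (c : E d) (ρ : ℝ) (x : E d) : 0 ≤ profile c ρ x := le_max_left _ _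

theorem profile_le_one (c : E d) (ρ : ℝ) (x : E d) : profile c ρ x ≤ 1 :=
  max_le zero_le_one (by linarith [show 0 ≤ ‖x - c‖ ^ 2 / ρ ^ 2 by positivity])

theorem continuous_profile (c : E d) (ρ : ℝ) : Continuous (profile c ρ) := by
  unfold profile; fun_prop

theorem profile_pos_iff {c : E d} {ρ : ℝ} (hρ : 0 < ρ) {x : E d} :
    0 < profile c ρ x ↔ x ∈ Metric.ball c ρ := by
  rw [profile, lt_max_iff, mem_ball_iff_norm]
  simp only [lt_irrefl, false_or, sub_pos]
  rw [div_lt_one (by positivity), sq_lt_sq₀ (norm_nonneg _) hρ.le]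

theorem profile_eq_zero {c : E d} {ρ : ℝ} (hρ : 0 < ρ) {x : E d} (hx : x ∉ Metric.ball c ρ) :
    profile c ρ x = 0 :=
  le_antisymm (not_lt.1 fun h => hx ((profile_pos_iff hρ).1 h)) (profile_nonneg _ _ _)

theorem profile_eq {c : E d} {ρ : ℝ} (hρ : 0 < ρ) {x : E d} (hx : x ∈ Metric.ball c ρ) :
    profile c ρ x = 1 - ‖x - c‖ ^ 2 / ρ ^ 2 := by
  have h := (profile_pos_iff hρ).2 hx
  rw [profile] at h ⊢
  exact max_eq_right ((lt_max_iff.1 h).resolve_left (lt_irrefl _)).le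

theorem integrable_profile (c : E d) {ρ : ℝ} (hρ : 0 < ρ) : Integrable (profile c ρ) := by
  refine (continuous_profile c ρ).integrable_of_hasCompactSupport ?_
  refine HasCompactSupport.of_support_subset_isCompact (isCompact_closedBall c ρ) fun x hx => ?_
  by_contra h
  exact hx (profile_eq_zero hρ fun h' => h (Metric.ball_subset_closedBall h'))

/-- The volume of the unit ball. -/
noncomputable def unitVolume (d : ℕ) : ℝ := volume.real (Metric.ball (0 : E d) 1)

theorem unitVolume_pos (d : ℕ) : 0 < unitVolume d :=
  ENNReal.toReal_pos (Metric.measure_ball_pos _ _ one_pos).ne' measure_ball_lt_top.ne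

theorem volume_real_ball (x : E d) {r : ℝ} (hr : 0 < r) :
    volume.real (Metric.ball x r) = unitVolume d * r ^ d := by
  rw [unitVolume, Measure.real, Measure.real, Measure.addHaar_ball_of_pos _ _ hr,
    ENNReal.toReal_mul, ENNReal.toReal_ofReal (by positivity), finrank_euclideanSpace,
    Fintype.card_fin, mul_comm]

/-- A lower bound for an integral over a ball by the values on a smaller ball inside it. -/
theorem mul_volume_le_setIntegral_profile {c x y : E d} {ρ δ r m : ℝ} (hρ : 0 < ρ) (hr : 0 < r)
    (hsub : Metric.ball y r ⊆ Metric.ball x δ) (hm : ∀ z ∈ Metric.ball y r, m ≤ profile c ρ z) :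
    m * (unitVolume d * r ^ d) ≤ ∫ z in Metric.ball x δ, profile c ρ z := by
  have hint := (integrable_profile c hρ).integrableOn (s := Metric.ball x δ)
  calc m * (unitVolume d * r ^ d) = ∫ _ in Metric.ball y r, m := by
        rw [setIntegral_const, volume_real_ball y hr, smul_eq_mul, mul_comm]
    _ ≤ ∫ z in Metric.ball y r, profile c ρ z :=
        setIntegral_mono_on (integrableOn_const measure_ball_lt_top.ne) (hint.mono_set hsub)
          measurableSet_ball hm
    _ ≤ _ := setIntegral_mono_set hint (ae_of_all _ fun z => profile_nonneg c ρ z)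
        (LE.le.eventuallyLE hsub)

/-- The ball of centre `x` and radius `δ` contains a homothetic image, of ratio `δ / (2 ρ)` and
centre `x`, of the half ball; concavity bounds the profile from below there. -/
theorem le_profile_of_mem_homothetic {c x z : E d} {ρ δ : ℝ} (hρ : 0 < ρ)
    (hx : x ∈ Metric.ball c ρ) (hδ : 0 < δ) (hδρ : δ ≤ 2 * ρ)
    (hz : z ∈ Metric.ball (x + (δ / (2 * ρ)) • (c - x)) (δ / 4)) :
    z ∈ Metric.ball x δ ∧
      (1 - δ / (2 * ρ)) * profile c ρ x + δ / (2 * ρ) * (3 / 4) ≤ profile c ρ z := by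
  set t := δ / (2 * ρ) with ht
  have ht0 : 0 < t := by positivity
  have ht1 : t ≤ 1 := by rw [ht, div_le_one (by positivity)]; exact hδρ
  have hδt : δ = 2 * ρ * t := by rw [ht]; field_simp
  have hx' := mem_ball_iff_norm.1 hx
  rw [mem_ball_iff_norm] at hz
  set v := z - (x + t • (c - x)) with hv
  have hzx : z - x = t • (c - x) + v := by rw [hv]; abel
  have hzc : z - c = (1 - t) • (x - c) + v := by rw [hv]; module
  have hvt : ‖v‖ < t * (ρ / 2) := by rw [hδt] at hz; linarith
  refine ⟨?_, ?_⟩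
  · rw [mem_ball_iff_norm, hzx]
    refine (norm_add_le _ _).trans_lt ?_
    rw [norm_smul, Real.norm_of_nonneg ht0.le, norm_sub_rev]
    nlinarith [mul_lt_mul_of_pos_left hx' ht0]
  · refine le_trans ?_ (le_max_right _ _)
    rw [profile_eq hρ hx]
    have h1 : ‖z - c‖ ≤ (1 - t) * ‖x - c‖ + t * (ρ / 2) := by
      rw [hzc]
      refine (norm_add_le _ _).trans ?_
      rw [norm_smul, Real.norm_of_nonneg (by linarith)]
      linarith
    have h2 : ‖z - c‖ ^ 2 ≤ (1 - t) * ‖x - c‖ ^ 2 + t * (ρ / 2) ^ 2 := by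
      have : ((1 - t) * ‖x - c‖ + t * (ρ / 2)) ^ 2 ≤
          (1 - t) * ‖x - c‖ ^ 2 + t * (ρ / 2) ^ 2 := by
        nlinarith [mul_nonneg (mul_nonneg ht0.le (sub_nonneg.2 ht1))
          (sq_nonneg (‖x - c‖ - ρ / 2))]
      exact (pow_le_pow_left₀ (norm_nonneg _) h1 2).trans this
    have h3 : ‖z - c‖ ^ 2 / ρ ^ 2 ≤ (1 - t) * (‖x - c‖ ^ 2 / ρ ^ 2) + t * (1 / 4) := by
      rw [div_le_iff₀ (by positivity)]
      refine h2.trans (le_of_eq ?_)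
      field_simp
      ring
    linarith

theorem homothetic_le_setIntegral_profile {c x : E d} {ρ δ : ℝ} (hρ : 0 < ρ)
    (hx : x ∈ Metric.ball c ρ) (hδ : 0 < δ) (hδρ : δ ≤ 2 * ρ) :
    ((1 - δ / (2 * ρ)) * profile c ρ x + δ / (2 * ρ) * (3 / 4)) * (unitVolume d * (δ / 4) ^ d) ≤
      ∫ z in Metric.ball x δ, profile c ρ z :=
  mul_volume_le_setIntegral_profile hρ (by positivity)
    (fun _ hz => (le_profile_of_mem_homothetic hρ hx hδ hδρ hz).1)
    (fun _ hz => (le_profile_of_mem_homothetic hρ hx hδ hδρ hz).2)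

/-- The minimal mass constant of the profile for radii up to the diameter of the ball. -/
noncomputable def profileConst (d : ℕ) : ℝ := 3 / 4 * unitVolume d / 4 ^ d

theorem profileConst_pos (d : ℕ) : 0 < profileConst d := by
  have := unitVolume_pos d
  unfold profileConst; positivity

theorem profileConst_mul_le {c x : E d} {ρ δ : ℝ} (hρ : 0 < ρ)
    (hx : x ∈ Metric.ball c ρ) (hδ : 0 < δ) (hδρ : δ ≤ 2 * ρ) :
    profileConst d * profile c ρ x * δ ^ d ≤ ∫ z in Metric.ball x δ, profile c ρ z := by
  refine le_trans ?_ (homothetic_le_setIntegral_profile hρ hx hδ hδρ)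
  have ht0 : 0 < δ / (2 * ρ) := by positivity
  have hu := unitVolume_pos d
  have hp := profile_nonneg c ρ x
  have hp1 := profile_le_one c ρ x
  rw [profileConst, div_pow]
  have e : 3 / 4 * unitVolume d / 4 ^ d * profile c ρ x * δ ^ d =
      (3 / 4 * profile c ρ x) * (unitVolume d * (δ ^ d / 4 ^ d)) := by ring
  rw [e]
  have ht1 : δ / (2 * ρ) ≤ 1 := by rw [div_le_one (by positivity)]; exact hδρ
  gcongr
  nlinarith

theorem profile_center {c : E d} {ρ : ℝ} : profile c ρ c = 1 := by simp [profile]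

theorem profileConst_le_integral (c : E d) {ρ : ℝ} (hρ : 0 < ρ) :
    profileConst d * (2 * ρ) ^ d ≤ ∫ z, profile c ρ z := by
  have h := profileConst_mul_le (d := d) hρ (Metric.mem_ball_self hρ : c ∈ _)
    (show 0 < 2 * ρ by positivity) le_rfl
  rw [profile_center, mul_one] at h
  exact h.trans (setIntegral_le_integral (integrable_profile c hρ)
    (ae_of_all _ fun z => profile_nonneg c ρ z))

theorem integral_profile_pos (c : E d) {ρ : ℝ} (hρ : 0 < ρ) : 0 < ∫ z, profile c ρ z :=
  (mul_pos (profileConst_pos d) (by positivity)).trans_le (profileConst_le_integral c hρ)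

/-- The integral of the odd part of the paraboloid over a ball vanishes, and the second-order term
costs at most `δ² / ρ²`. -/
theorem sub_sq_mul_volume_le_setIntegral_profile {c x : E d} {ρ δ : ℝ} (hρ : 0 < ρ)
    (hx : x ∈ Metric.ball c ρ) (hδ : 0 < δ) :
    (profile c ρ x - δ ^ 2 / ρ ^ 2) * (unitVolume d * δ ^ d) ≤
      ∫ z in Metric.ball x δ, profile c ρ z := by
  -- The reflection of the ball in its centre changes the sign of the linear term.
  have hlin : ∫ z in Metric.ball x δ, inner ℝ (x - c) (z - x) = 0 := by
    have h1 : ∫ z in Metric.ball x δ, inner ℝ (x - c) (z - x) =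
        ∫ v, (Metric.ball (0 : E d) δ).indicator (fun v => inner ℝ (x - c) v) v := by
      rw [← integral_indicator measurableSet_ball,
        ← integral_sub_right_eq_self (fun v => (Metric.ball (0 : E d) δ).indicator
          (fun v => inner ℝ (x - c) v) v) x]
      congr 1
      ext z
      simp only [Set.indicator, mem_ball_iff_norm, sub_zero]
    rw [h1]
    have h2 := integral_neg_eq_self (μ := volume)
      ((Metric.ball (0 : E d) δ).indicator fun v => inner ℝ (x - c) v)
    have h3 (v : E d) : (Metric.ball (0 : E d) δ).indicator (fun v => inner ℝ (x - c) v) (-v) =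
        -(Metric.ball (0 : E d) δ).indicator (fun v => inner ℝ (x - c) v) v := by
      by_cases hv : v ∈ Metric.ball (0 : E d) δ
      · rw [Set.indicator_of_mem hv, Set.indicator_of_mem (by simpa using hv), inner_neg_right]
      · rw [Set.indicator_of_notMem hv, Set.indicator_of_notMem (by simpa using hv), neg_zero]
    simp_rw [h3, integral_neg] at h2
    linarith
  have hfin : volume (Metric.ball x δ) ≠ ⊤ := measure_ball_lt_top.ne
  have hil : IntegrableOn (fun z => 2 / ρ ^ 2 * inner ℝ (x - c) (z - x)) (Metric.ball x δ) := by
    have hcont : Continuous fun z => 2 / ρ ^ 2 * inner ℝ (x - c) (z - x) := by fun_prop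
    exact (hcont.continuousOn.integrableOn_compact (isCompact_closedBall x δ)).mono_set
      Metric.ball_subset_closedBall
  have hic : IntegrableOn (fun _ : E d => profile c ρ x - δ ^ 2 / ρ ^ 2) (Metric.ball x δ) :=
    integrableOn_const hfin
  calc (profile c ρ x - δ ^ 2 / ρ ^ 2) * (unitVolume d * δ ^ d)
      = ∫ z in Metric.ball x δ, ((profile c ρ x - δ ^ 2 / ρ ^ 2) -
          2 / ρ ^ 2 * inner ℝ (x - c) (z - x)) := by
        rw [integral_sub hic hil, integral_const_mul, hlin, mul_zero,
          sub_zero, setIntegral_const, volume_real_ball x hδ, smul_eq_mul, mul_comm]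
    _ ≤ ∫ z in Metric.ball x δ, profile c ρ z := by
        refine setIntegral_mono_on (hic.sub hil)
          (integrable_profile c hρ).integrableOn measurableSet_ball fun z hz => ?_
        refine le_trans ?_ (le_max_right _ _)
        have hz' : ‖z - x‖ ^ 2 ≤ δ ^ 2 :=
          pow_le_pow_left₀ (norm_nonneg _) (mem_ball_iff_norm.1 hz).le 2
        have e : ‖z - c‖ ^ 2 = ‖x - c‖ ^ 2 + 2 * inner ℝ (x - c) (z - x) + ‖z - x‖ ^ 2 := by
          rw [← norm_add_sq_real]; congr 2; abel
        have hdiv : ‖z - x‖ ^ 2 / ρ ^ 2 ≤ δ ^ 2 / ρ ^ 2 := by gcongr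
        rw [profile_eq hρ hx, e, add_div, add_div, mul_div_right_comm]
        linarith

/-- For small radii the profile has the minimal mass property with any constant below the volume of
the unit ball. Where the profile dominates `δ²`, its mean over the ball is nearly its value at the
centre; elsewhere the homothetic ball alone carries mass of order `δ ^ (d + 1)`. -/
theorem exists_mul_le_setIntegral_profile {κ : ℝ} (hκ : κ < unitVolume d) {ρ : ℝ} (hρ : 0 < ρ) :
    ∃ δ₀ : ℝ, 0 < δ₀ ∧ ∀ δ : ℝ, 0 < δ → δ ≤ δ₀ → ∀ c : E d, ∀ x ∈ Metric.ball c ρ,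
      κ * profile c ρ x * δ ^ d ≤ ∫ z in Metric.ball x δ, profile c ρ z := by
  have hu := unitVolume_pos d
  set e := 1 - κ / unitVolume d with he
  have he0 : 0 < e := by rw [he, sub_pos, div_lt_one hu]; exact hκ
  have hκe : κ = (1 - e) * unitVolume d := by rw [he]; field_simp; ring
  -- The second bound makes the mass of the homothetic ball at least `unitVolume d * δ ^ d` times
  -- `δ² / (e ρ²)`, which bounds the profile at `x` wherever `e * profile` is at most `δ² / ρ²`.
  refine ⟨min ρ (3 / 8 * ρ / 4 ^ d * e), by positivity, fun δ hδ hδ₀ c x hx => ?_⟩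
  have hδ1 := hδ₀.trans (min_le_left _ _)
  have hδ2 := hδ₀.trans (min_le_right _ _)
  rcases le_total (δ ^ 2 / ρ ^ 2) (e * profile c ρ x) with h | h
  · refine le_trans ?_ (sub_sq_mul_volume_le_setIntegral_profile hρ hx hδ)
    have : κ * profile c ρ x * δ ^ d = ((1 - e) * profile c ρ x) * (unitVolume d * δ ^ d) := by
      rw [hκe]; ring
    rw [this]
    gcongr
    linarith
  · refine le_trans ?_ (homothetic_le_setIntegral_profile hρ hx hδ (by linarith))
    have hp := profile_nonneg c ρ x
    have ht1 : δ / (2 * ρ) ≤ 1 := by rw [div_le_one (by positivity)]; linarith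
    have h1 : profile c ρ x * 4 ^ d ≤ δ / (2 * ρ) * (3 / 4) := by
      have h2 : e * (profile c ρ x * 4 ^ d) ≤ e * (δ / (2 * ρ) * (3 / 4)) := by
        calc e * (profile c ρ x * 4 ^ d) = e * profile c ρ x * 4 ^ d := by ring
          _ ≤ δ ^ 2 / ρ ^ 2 * 4 ^ d := by gcongr
          _ = δ / ρ ^ 2 * 4 ^ d * δ := by ring
          _ ≤ δ / ρ ^ 2 * 4 ^ d * (3 / 8 * ρ / 4 ^ d * e) := by gcongr
          _ = e * (δ / (2 * ρ) * (3 / 4)) := by field_simp; ring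
      exact le_of_mul_le_mul_left h2 he0
    have h3 : 0 ≤ (1 - δ / (2 * ρ)) * profile c ρ x := mul_nonneg (by linarith) hp
    calc κ * profile c ρ x * δ ^ d ≤ unitVolume d * profile c ρ x * δ ^ d := by gcongr
      _ = profile c ρ x * 4 ^ d * (unitVolume d * (δ / 4) ^ d) := by
          rw [div_pow]; field_simp
      _ ≤ _ := by gcongr; linarith

/-! ### Mixtures of profiles on separated balls -/

/-- A finite family of balls at mutual distance at least `gap`, with positive weights of total
mass one. -/
structure BallMixture (d : ℕ) (ι : Type*) [Fintype ι] where
  center : ι → E d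
  radius : ι → ℝ
  radius_pos : ∀ i, 0 < radius i
  weight : ι → ℝ
  weight_pos : ∀ i, 0 < weight i
  sum_weight : ∑ i, weight i = 1
  gap : ℝ
  gap_pos : 0 < gap
  separated : ∀ i j, i ≠ j → radius i + radius j + gap ≤ ‖center i - center j‖

namespace BallMixture

variable {ι : Type*} [Fintype ι] (B : BallMixture d ι)

/-- The `i`-th ball. -/
def ball (i : ι) : Set (E d) := Metric.ball (B.center i) (B.radius i)

/-- The factor that gives the profile on the `i`-th ball the mass `weight i`. -/
noncomputable def height (i : ι) : ℝ :=
  B.weight i / ∫ z, profile (B.center i) (B.radius i) z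

/-- The density of the mixture. -/
noncomputable def density (x : E d) : ℝ :=
  ∑ i, B.height i * profile (B.center i) (B.radius i) x

/-- The probability measure with the density of the mixture. -/
noncomputable def marginal : Measure (E d) :=
  volume.withDensity fun x => ENNReal.ofReal (B.density x)

/-- The regression function that equals `1 / 2 + b i` on the `i`-th ball and `1 / 2` elsewhere. -/
noncomputable def regression (b : ι → ℝ) (x : E d) : ℝ :=
  1 / 2 + ∑ i, (B.ball i).indicator (fun _ => b i) x

theorem measurableSet_ball (i : ι) : MeasurableSet (B.ball i) := Metric.isOpen_ball.measurableSet

theorem height_pos (i : ι) : 0 < B.height i :=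
  div_pos (B.weight_pos i) (integral_profile_pos _ (B.radius_pos i))

theorem gap_le_norm_sub {i j : ι} (hij : i ≠ j) {x y : E d} (hx : x ∈ B.ball i)
    (hy : y ∈ B.ball j) : B.gap ≤ ‖x - y‖ := by
  have h := B.separated i j hij
  rw [ball, mem_ball_iff_norm] at hx hy
  have e : B.center i - B.center j = -(x - B.center i) + (x - y) + (y - B.center j) := by abel
  have h1 : ‖B.center i - B.center j‖ ≤ ‖x - B.center i‖ + ‖x - y‖ + ‖y - B.center j‖ := by
    rw [e, ← norm_neg (x - B.center i)]
    exact norm_add₃_le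
  linarith

theorem eq_of_mem {i j : ι} {x : E d} (hi : x ∈ B.ball i) (hj : x ∈ B.ball j) : i = j := by
  by_contra h
  have := B.gap_le_norm_sub h hi hj
  simp only [sub_self, norm_zero] at this
  exact absurd B.gap_pos (not_lt.2 this)

theorem density_of_mem {i : ι} {x : E d} (hi : x ∈ B.ball i) :
    B.density x = B.height i * profile (B.center i) (B.radius i) x :=
  Finset.sum_eq_single i (fun j _ hj => by
    rw [profile_eq_zero (B.radius_pos j) fun h => hj (B.eq_of_mem h hi), mul_zero]) (by simp)

theorem density_of_notMem {x : E d} (h : ∀ i, x ∉ B.ball i) : B.density x = 0 :=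
  Finset.sum_eq_zero fun i _ => by rw [profile_eq_zero (B.radius_pos i) (h i), mul_zero]

theorem density_nonneg (x : E d) : 0 ≤ B.density x :=
  Finset.sum_nonneg fun i _ => mul_nonneg (B.height_pos i).le (profile_nonneg _ _ _)

theorem height_mul_profile_le_density (i : ι) (x : E d) :
    B.height i * profile (B.center i) (B.radius i) x ≤ B.density x :=
  Finset.single_le_sum (f := fun i => B.height i * profile (B.center i) (B.radius i) x)
    (fun i _ => mul_nonneg (B.height_pos i).le (profile_nonneg _ _ _)) (Finset.mem_univ i)

theorem exists_mem_of_density_pos {x : E d} (h : 0 < B.density x) : ∃ i, x ∈ B.ball i := by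
  by_contra! hx
  exact h.ne' (B.density_of_notMem hx)

theorem regression_of_mem (b : ι → ℝ) {i : ι} {x : E d} (hi : x ∈ B.ball i) :
    B.regression b x = 1 / 2 + b i := by
  rw [regression, Finset.sum_eq_single i, Set.indicator_of_mem hi]
  · exact fun j _ hj => Set.indicator_of_notMem (fun h => hj (B.eq_of_mem h hi)) _
  · simp

theorem regression_of_notMem (b : ι → ℝ) {x : E d} (h : ∀ i, x ∉ B.ball i) :
    B.regression b x = 1 / 2 := by
  rw [regression, Finset.sum_eq_zero fun i _ => Set.indicator_of_notMem (h i) _, add_zero]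

theorem continuous_density : Continuous B.density :=
  continuous_finsetSum _ fun _ _ => continuous_const.mul (continuous_profile _ _)

theorem integrable_density : Integrable B.density :=
  integrable_finsetSum _ fun i _ => (integrable_profile _ (B.radius_pos i)).const_mul _

theorem integral_density : ∫ x, B.density x = 1 := by
  unfold density
  rw [integral_finsetSum _ fun i _ => (integrable_profile _ (B.radius_pos i)).const_mul _,
    ← B.sum_weight]
  refine Finset.sum_congr rfl fun i _ => ?_
  rw [integral_const_mul, height, div_mul_cancel₀]
  exact (integral_profile_pos _ (B.radius_pos i)).ne'

/-- The model with the density of the mixture and a regression function that is constant on each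
ball. -/
noncomputable def model (b : ι → ℝ) (hb : ∀ i, |b i| ≤ 1 / 2) : Model d where
  density := B.density
  measurable_density := B.continuous_density.measurable
  density_nonneg := B.density_nonneg
  lintegral_density := by
    rw [← ofReal_integral_eq_lintegral_ofReal B.integrable_density (ae_of_all _ B.density_nonneg),
      B.integral_density, ENNReal.ofReal_one]
  isOpen_pos := isOpen_lt continuous_const B.continuous_density
  regression := B.regression b
  measurable_regression := measurable_const.add <| Finset.measurable_sum _ fun i _ =>
    measurable_const.indicator (B.measurableSet_ball i)
  regression_mem x := by
    by_cases h : ∃ i, x ∈ B.ball i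
    · obtain ⟨i, hi⟩ := h
      rw [B.regression_of_mem b hi]
      have := abs_le.1 (hb i)
      constructor <;> linarith
    · rw [B.regression_of_notMem b (not_exists.1 h)]
      norm_num

theorem model_marginal (b : ι → ℝ) (hb : ∀ i, |b i| ≤ 1 / 2) :
    (B.model b hb).marginal = B.marginal := rfl

instance : IsProbabilityMeasure B.marginal := by
  rw [← B.model_marginal 0 (by simp)]
  infer_instance

theorem marginal_real_apply {A : Set (E d)} (hA : MeasurableSet A) :
    B.marginal.real A = ∫ x in A, B.density x := by
  rw [Measure.real, marginal, withDensity_apply _ hA,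
    ← ofReal_integral_eq_lintegral_ofReal B.integrable_density.integrableOn
      (ae_of_all _ B.density_nonneg),
    ENNReal.toReal_ofReal (setIntegral_nonneg hA fun x _ => B.density_nonneg x)]

theorem marginal_real_ball (i : ι) : B.marginal.real (B.ball i) = B.weight i := by
  rw [B.marginal_real_apply (B.measurableSet_ball i),
    setIntegral_congr_fun (B.measurableSet_ball i) fun x hx => B.density_of_mem hx,
    integral_const_mul, setIntegral_eq_integral_of_forall_compl_eq_zero (s := B.ball i)
      fun x hx => profile_eq_zero (B.radius_pos i) hx, height, div_mul_cancel₀]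
  exact (integral_profile_pos _ (B.radius_pos i)).ne'

theorem marginal_ball (i : ι) : B.marginal (B.ball i) = ENNReal.ofReal (B.weight i) := by
  rw [← B.marginal_real_ball i, Measure.real, ENNReal.ofReal_toReal (measure_ne_top _ _)]

theorem height_mul_setIntegral_le (i : ι) (x : E d) (δ : ℝ) :
    B.height i * ∫ z in Metric.ball x δ, profile (B.center i) (B.radius i) z ≤
      B.marginal.real (Metric.ball x δ) := by
  rw [B.marginal_real_apply Metric.isOpen_ball.measurableSet, ← integral_const_mul]
  exact setIntegral_mono ((integrable_profile _ (B.radius_pos i)).const_mul _).integrableOn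
    B.integrable_density.integrableOn fun z => B.height_mul_profile_le_density i z

theorem profileConst_mul_density_le {i : ι} {x : E d} (hx : x ∈ B.ball i) {δ : ℝ} (hδ : 0 < δ)
    (hδi : δ ≤ 2 * B.radius i) :
    profileConst d * B.density x * δ ^ d ≤ B.marginal.real (Metric.ball x δ) := by
  rw [B.density_of_mem hx]
  refine le_trans ?_ (B.height_mul_setIntegral_le i x δ)
  have := mul_le_mul_of_nonneg_left (profileConst_mul_le (B.radius_pos i) hx hδ hδi)
    (B.height_pos i).le
  linarith

theorem sum_weight_le (s : Finset ι) {A : Set (E d)} (hs : ∀ i ∈ s, B.ball i ⊆ A) :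
    ∑ i ∈ s, B.weight i ≤ B.marginal.real A := by
  have h : B.marginal.real (⋃ i ∈ s, B.ball i) = ∑ i ∈ s, B.marginal.real (B.ball i) :=
    measureReal_biUnion_finset (fun i _ j _ hij => Set.disjoint_left.2 fun x hi hj =>
      hij (B.eq_of_mem hi hj)) fun i _ => B.measurableSet_ball i
  simp_rw [marginal_real_ball] at h
  rw [← h]
  exact measureReal_mono (Set.iUnion₂_subset hs)

/-- Amplitudes `0` and `τ` give the margin condition as soon as the mass of the balls with amplitude
`τ` is at most `C τ ^ α`. -/
theorem mem_smoothMargin {b : ι → ℝ} (hb : ∀ i, |b i| ≤ 1 / 2) {L α C τ : ℝ} (hL : 0 < L)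
    (hα : 0 < α) (hC : 0 < C) (hτ : 0 < τ) (hLip : ∀ i j, |b i - b j| ≤ L * B.gap)
    (hbτ : ∀ i, b i = 0 ∨ |b i| = τ) {s : Finset ι} (hs : ∀ i, i ∉ s → b i = 0)
    (hmass : ∑ i ∈ s, B.weight i ≤ C * τ ^ α) :
    B.model b hb ∈ smoothMargin d L α C := by
  refine ⟨fun x hx y hy => ?_, fun ε hε => ?_⟩
  · obtain ⟨i, hi⟩ := B.exists_mem_of_density_pos hx
    obtain ⟨j, hj⟩ := B.exists_mem_of_density_pos hy
    change |B.regression b x - B.regression b y| ≤ _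
    rw [B.regression_of_mem b hi, B.regression_of_mem b hj]
    by_cases hij : i = j
    · rw [hij, sub_self, abs_zero]
      positivity
    · have e : 1 / 2 + b i - (1 / 2 + b j) = b i - b j := by ring
      rw [e]
      exact (hLip i j).trans (mul_le_mul_of_nonneg_left (B.gap_le_norm_sub hij hi hj) hL.le)
  · rw [B.model_marginal]
    change B.marginal.real {x | 0 < |B.regression b x - 1 / 2| ∧ |B.regression b x - 1 / 2| < ε} ≤ _
    have hval {x : E d} (hx : 0 < |B.regression b x - 1 / 2|) :
        |B.regression b x - 1 / 2| = τ ∧ ∃ i ∈ s, x ∈ B.ball i := by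
      by_cases h : ∃ i, x ∈ B.ball i
      · obtain ⟨i, hi⟩ := h
        rw [B.regression_of_mem b hi, add_sub_cancel_left] at hx ⊢
        have hne : b i ≠ 0 := abs_pos.1 hx
        exact ⟨(hbτ i).resolve_left hne, i, by_contra fun h => hne (hs i h), hi⟩
      · rw [B.regression_of_notMem b (not_exists.1 h)] at hx
        simp at hx
    -- The margin takes no value in `(0, τ)`, so only `ε > τ` matters.
    rcases le_or_gt ε τ with h | h
    · have : {x | 0 < |B.regression b x - 1 / 2| ∧ |B.regression b x - 1 / 2| < ε} = ∅ :=
        Set.eq_empty_of_forall_notMem fun x hx => by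
          have := (hval hx.1).1
          linarith [hx.2]
      rw [this, measureReal_empty]
      positivity
    · calc B.marginal.real {x | 0 < |B.regression b x - 1 / 2| ∧ |B.regression b x - 1 / 2| < ε}
          ≤ B.marginal.real (⋃ i ∈ s, B.ball i) :=
            measureReal_mono (fun x hx => by simpa using (hval hx.1).2) (measure_ne_top _ _)
        _ ≤ ∑ i ∈ s, B.marginal.real (B.ball i) := measureReal_biUnion_finset_le _ _
        _ = ∑ i ∈ s, B.weight i := by simp_rw [marginal_real_ball]
        _ ≤ C * τ ^ α := hmass
        _ ≤ C * ε ^ α := by gcongr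

theorem mem_minimalMass {b : ι → ℝ} (hb : ∀ i, |b i| ≤ 1 / 2) {κ : ℝ} (hκ : κ < unitVolume d) :
    B.model b hb ∈ minimalMass d κ := by
  choose δ hδ h using fun i => exists_mul_le_setIntegral_profile hκ (B.radius_pos i)
  obtain ⟨δ₀, h0, hle⟩ : ∃ δ₀ : ℝ, 0 < δ₀ ∧ ∀ i, δ₀ ≤ δ i := by
    obtain ⟨m, hm⟩ := (Set.finite_range fun i => (δ i)⁻¹).bddAbove
    refine ⟨(max m 1)⁻¹, by positivity, fun i => inv_le_of_inv_le₀ (hδ i) ?_⟩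
    exact (hm ⟨i, rfl⟩).trans (le_max_left _ _)
  refine ⟨δ₀, h0, fun r hr hr0 x hx => ?_⟩
  obtain ⟨i, hi⟩ := B.exists_mem_of_density_pos hx
  change κ * B.density x * r ^ d ≤ B.marginal.real _
  rw [B.density_of_mem hi]
  refine le_trans ?_ (B.height_mul_setIntegral_le i x r)
  have := mul_le_mul_of_nonneg_left (h i r hr (hr0.trans (hle i)) _ x hi) (B.height_pos i).le
  linarith

/-- The tail condition holds for every density whose support has volume at most one. -/
theorem mem_tail {b : ι → ℝ} (hb : ∀ i, |b i| ≤ 1 / 2)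
    (hvol : ∑ i, unitVolume d * B.radius i ^ d ≤ 1) (ε₀ : ℝ) :
    B.model b hb ∈ tail d id ε₀ := by
  intro ε hε _
  change B.marginal.real {x | B.density x < ε} ≤ ε
  have hA : MeasurableSet {x | B.density x < ε} :=
    (isOpen_lt B.continuous_density continuous_const).measurableSet
  rw [B.marginal_real_apply hA]
  have hi (i : ι) : Integrable ((B.ball i).indicator fun _ => ε) :=
    (integrable_indicator_iff (B.measurableSet_ball i)).2
      (integrableOn_const measure_ball_lt_top.ne)
  have hnn (x : E d) (i : ι) : 0 ≤ (B.ball i).indicator (fun _ => ε) x :=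
    Set.indicator_nonneg (fun _ _ => hε.le) x
  have hint : Integrable fun x => ∑ i, (B.ball i).indicator (fun _ => ε) x :=
    integrable_finsetSum _ fun i _ => hi i
  calc ∫ x in {x | B.density x < ε}, B.density x
      ≤ ∫ x in {x | B.density x < ε}, ∑ i, (B.ball i).indicator (fun _ => ε) x := by
        refine setIntegral_mono_on B.integrable_density.integrableOn hint.integrableOn hA
          fun x hx => ?_
        by_cases h : ∃ i, x ∈ B.ball i
        · obtain ⟨i, hxi⟩ := h
          refine (le_of_lt hx).trans ?_
          have := Finset.single_le_sum (fun i _ => hnn x i) (Finset.mem_univ i)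
          rwa [Set.indicator_of_mem hxi] at this
        · rw [B.density_of_notMem (not_exists.1 h)]
          exact Finset.sum_nonneg fun i _ => hnn x i
    _ ≤ ∫ x, ∑ i, (B.ball i).indicator (fun _ => ε) x :=
        setIntegral_le_integral hint (ae_of_all _ fun x => Finset.sum_nonneg fun i _ => hnn x i)
    _ = ε * ∑ i, unitVolume d * B.radius i ^ d := by
        rw [integral_finsetSum _ fun i _ => hi i, Finset.mul_sum]
        refine Finset.sum_congr rfl fun i _ => ?_
        rw [integral_indicator (B.measurableSet_ball i), setIntegral_const, smul_eq_mul, ball,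
          volume_real_ball _ (B.radius_pos i), mul_comm]
    _ ≤ ε := mul_le_of_le_one_right hε.le hvol

end BallMixture

/-! ### Densities of the labelled law -/

/-- Two copies of a measure, one for each label. It dominates the laws of all models with the given
marginal. -/
noncomputable def labelled (μ : Measure (E d)) : Measure (E d × Bool) :=
  μ.map (fun x => (x, true)) + μ.map (fun x => (x, false))

instance (μ : Measure (E d)) [IsFiniteMeasure μ] : IsFiniteMeasure (labelled μ) := by
  unfold labelled; infer_instance

theorem lintegral_labelled (μ : Measure (E d)) {f : E d × Bool → ℝ≥0∞} (hf : Measurable f) :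
    ∫⁻ z, f z ∂(labelled μ) = ∫⁻ x, f (x, true) + f (x, false) ∂μ := by
  rw [labelled, lintegral_add_measure, lintegral_map hf (by fun_prop),
    lintegral_map hf (by fun_prop)]
  exact (lintegral_add_left (hf.comp measurable_prodMk_right) _).symm

theorem measurable_prod_bool {β : Type*} [MeasurableSpace β] {f : E d × Bool → β}
    (h : ∀ y, Measurable fun x => f (x, y)) : Measurable f :=
  measurable_from_prod_countable_left h

namespace Model

/-- The density of the law of `(X, Y)` with respect to `labelled M.marginal`. -/
noncomputable def labelDensity (M : Model d) (z : E d × Bool) : ℝ≥0 :=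
  Real.toNNReal (if z.2 then M.regression z.1 else 1 - M.regression z.1)

theorem measurable_labelDensity (M : Model d) : Measurable M.labelDensity := by
  refine measurable_prod_bool fun y => ?_
  cases y
  · simpa [labelDensity] using (measurable_const.sub M.measurable_regression).real_toNNReal
  · simpa [labelDensity] using M.measurable_regression.real_toNNReal

theorem law_eq_withDensity (M : Model d) :
    M.law = (labelled M.marginal).withDensity fun z => (M.labelDensity z : ℝ≥0∞) := by
  ext A hA
  have h1 : MeasurableSet ((fun x : E d => (x, true)) ⁻¹' A) := measurable_prodMk_right hA
  have h2 : MeasurableSet ((fun x : E d => (x, false)) ⁻¹' A) := measurable_prodMk_right hA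
  have hm := M.measurable_labelDensity.coe_nnreal_ennreal
  rw [withDensity_apply _ hA, ← lintegral_indicator hA,
    lintegral_labelled _ (hm.indicator hA), law, Measure.add_apply,
    Measure.map_apply (by fun_prop) hA, Measure.map_apply (by fun_prop) hA,
    withDensity_apply _ h1, withDensity_apply _ h2, ← lintegral_indicator h1,
    ← lintegral_indicator h2, ← lintegral_add_left
      (M.measurable_regression.ennreal_ofReal.indicator h1)]
  rfl

/-- The misclassification probability of a fixed classifier, as an integral over the marginal. -/
theorem law_ne (M : Model d) {φ : E d → Bool} (hφ : Measurable φ) :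
    M.law {z | φ z.1 ≠ z.2} =
      ∫⁻ x, ENNReal.ofReal (if φ x then 1 - M.regression x else M.regression x) ∂M.marginal := by
  have hA : MeasurableSet {z : E d × Bool | φ z.1 ≠ z.2} :=
    (measurableSet_eq_fun (hφ.comp measurable_fst) measurable_snd).compl
  rw [law_eq_withDensity, withDensity_apply _ hA, ← lintegral_indicator hA,
    lintegral_labelled _ (M.measurable_labelDensity.coe_nnreal_ennreal.indicator hA)]
  refine lintegral_congr fun x => ?_
  cases h : φ x <;> simp [Set.indicator, h, labelDensity, ENNReal.ofReal]

theorem measurable_bayes (M : Model d) : Measurable M.bayes := by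
  refine measurable_to_bool ?_
  have : M.bayes ⁻¹' {true} = {x | 1 / 2 < M.regression x} := by ext; simp [bayes]
  rw [this]
  exact measurableSet_lt measurable_const M.measurable_regression

end Model

namespace BallMixture

variable {ι : Type*}

/-! ### Excess risk over a hypercube of regression functions -/

/-- The perturbation of amplitude `t` with signs `σ`. -/
def signed (t : ι → ℝ) (σ : ι → Bool) (i : ι) : ℝ := if σ i then t i else -t i

theorem abs_signed {t : ι → ℝ} (ht : ∀ i, 0 ≤ t i) (σ : ι → Bool) (i : ι) :
    |signed t σ i| = t i := by
  unfold signed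
  split <;> simp [abs_of_nonneg (ht i)]

theorem abs_signed_le {t : ι → ℝ} (ht : ∀ i, 0 ≤ t i) (ht' : ∀ i, t i ≤ 1 / 2) (σ : ι → Bool)
    (i : ι) : |signed t σ i| ≤ 1 / 2 := by
  rw [abs_signed ht]; exact ht' i

variable [Fintype ι] (B : BallMixture d ι)

/-- The mass of the points of the `i`-th ball that the classifier does not label by `v`. -/
noncomputable def missMass {n : ℕ} (Φ : Classifier d n) (i : ι) (v : Bool)
    (S : Fin n → E d × Bool) : ℝ≥0∞ :=
  B.marginal (B.ball i ∩ {x | Φ.rule S x ≠ v})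

theorem measurable_missMass {n : ℕ} (Φ : Classifier d n) (i : ι) (v : Bool) :
    Measurable (B.missMass Φ i v) := by
  have h : MeasurableSet {z : (Fin n → E d × Bool) × E d | z.2 ∈ B.ball i ∧ Φ.rule z.1 z.2 ≠ v} :=
    (measurable_snd (B.measurableSet_ball i)).inter
      (Φ.measurable_rule (measurableSet_singleton v).compl)
  exact measurable_measure_prodMk_left h

theorem marginal_ball_le_missMass_add {n : ℕ} (Φ : Classifier d n) (i : ι) (v : Bool)
    (S : Fin n → E d × Bool) :
    ENNReal.ofReal (B.weight i) ≤ B.missMass Φ i v S + B.missMass Φ i (!v) S := by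
  rw [← B.marginal_ball i]
  refine (measure_mono fun x hx => ?_).trans (measure_union_le _ _)
  by_cases h : Φ.rule S x = v
  · exact Or.inr ⟨hx, by simp [h]⟩
  · exact Or.inl ⟨hx, h⟩

/-- Every mislabelled point of the `i`-th ball costs `2 t i` more than the Bayes label. -/
theorem law_bayes_add_le {t : ι → ℝ} (ht : ∀ i, 0 ≤ t i) (ht' : ∀ i, t i ≤ 1 / 2)
    (σ : ι → Bool) {φ : E d → Bool} (hφ : Measurable φ) :
    let M := B.model (signed t σ) (abs_signed_le ht ht' σ)
    M.law {z | M.bayes z.1 ≠ z.2} +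
        ∑ i, ENNReal.ofReal (2 * t i) * B.marginal (B.ball i ∩ {x | φ x ≠ σ i}) ≤
      M.law {z | φ z.1 ≠ z.2} := by
  intro M
  have hset (i : ι) : MeasurableSet (B.ball i ∩ {x | φ x ≠ σ i}) :=
    (B.measurableSet_ball i).inter (hφ (measurableSet_singleton _).compl)
  have hcost {ψ : E d → Bool} (hψ : Measurable ψ) : Measurable fun x =>
      ENNReal.ofReal (if ψ x then 1 - M.regression x else M.regression x) :=
    (Measurable.ite (hψ (measurableSet_singleton true))
      (measurable_const.sub M.measurable_regression) M.measurable_regression).ennreal_ofReal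
  have hsum : ∑ i, ENNReal.ofReal (2 * t i) * B.marginal (B.ball i ∩ {x | φ x ≠ σ i}) =
      ∫⁻ x, ∑ i, (B.ball i ∩ {x | φ x ≠ σ i}).indicator
        (fun _ => ENNReal.ofReal (2 * t i)) x ∂M.marginal := by
    rw [lintegral_finsetSum _ fun i _ => measurable_const.indicator (hset i)]
    refine Finset.sum_congr rfl fun i _ => ?_
    rw [lintegral_indicator (hset i), setLIntegral_const]
    rfl
  rw [hsum, M.law_ne hφ, M.law_ne M.measurable_bayes, ← lintegral_add_left
    (hcost M.measurable_bayes)]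
  refine lintegral_mono fun x => ?_
  by_cases hx : ∃ i, x ∈ B.ball i
  · obtain ⟨i, hi⟩ := hx
    have hη : M.regression x = 1 / 2 + signed t σ i := B.regression_of_mem _ hi
    rw [Finset.sum_eq_single i (fun j _ hj => Set.indicator_of_notMem
      (fun h => hj (B.eq_of_mem h.1 hi)) _) (by simp)]
    have hbayes : M.bayes x = decide (0 < signed t σ i) := by
      unfold Model.bayes
      rw [hη]
      simp
    have h0 := ht i
    have h1 := ht' i
    -- If `t i = 0` both labels have conditional risk `1 / 2`, and otherwise `σ i` is the Bayes label.
    by_cases hv : φ x = σ i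
    · rw [Set.indicator_of_notMem (fun h => h.2 hv), add_zero, hη, hbayes, hv]
      refine ENNReal.ofReal_le_ofReal ?_
      cases hσ : σ i <;> simp only [signed, hσ] <;> grind
    · rw [Set.indicator_of_mem (show x ∈ B.ball i ∩ {x | φ x ≠ σ i} from ⟨hi, hv⟩), hη, hbayes,
        Bool.eq_not.2 hv, ← ENNReal.ofReal_add _ (by linarith)]
      · refine ENNReal.ofReal_le_ofReal ?_
        cases hσ : σ i <;> simp only [signed, hσ] <;> grind
      · have := abs_le.1 (abs_signed_le ht ht' σ i)
        split <;> linarith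
  · rw [Finset.sum_eq_zero fun i _ => Set.indicator_of_notMem
      (fun h => hx ⟨i, h.1⟩) _, add_zero]
    have hη : M.regression x = 1 / 2 := B.regression_of_notMem _ (not_exists.1 hx)
    rw [hη]
    norm_num

/-- The mean of the mass that the classifier mislabels in the `i`-th ball. -/
noncomputable def meanMiss {t : ι → ℝ} (ht : ∀ i, 0 ≤ t i) (ht' : ∀ i, t i ≤ 1 / 2) {n : ℕ}
    (Φ : Classifier d n) (σ : ι → Bool) (i : ι) : ℝ≥0∞ :=
  ∫⁻ S, B.missMass Φ i (σ i) S
    ∂(Measure.pi fun _ : Fin n => (B.model (signed t σ) (abs_signed_le ht ht' σ)).law)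

theorem meanMiss_ne_top {t : ι → ℝ} (ht : ∀ i, 0 ≤ t i) (ht' : ∀ i, t i ≤ 1 / 2) {n : ℕ}
    (Φ : Classifier d n) (σ : ι → Bool) (i : ι) : B.meanMiss ht ht' Φ σ i ≠ ⊤ := by
  refine ne_top_of_le_ne_top ENNReal.one_ne_top ?_
  calc B.meanMiss ht ht' Φ σ i ≤ ∫⁻ _, 1
        ∂(Measure.pi fun _ : Fin n => (B.model (signed t σ) (abs_signed_le ht ht' σ)).law) :=
        lintegral_mono fun S => prob_le_one
    _ = 1 := by simp

theorem sum_meanMiss_le_excessRisk {t : ι → ℝ} (ht : ∀ i, 0 ≤ t i) (ht' : ∀ i, t i ≤ 1 / 2)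
    {n : ℕ} (Φ : Classifier d n) (σ : ι → Bool) :
    ∑ i, 2 * t i * (B.meanMiss ht ht' Φ σ i).toReal ≤
      excessRisk (B.model (signed t σ) (abs_signed_le ht ht' σ)) Φ := by
  set M := B.model (signed t σ) (abs_signed_le ht ht' σ) with hM
  set P := Measure.pi fun _ : Fin n => M.law with hP
  have hset : MeasurableSet {z : (Fin n → E d × Bool) × (E d × Bool) |
      Φ.rule z.1 z.2.1 ≠ z.2.2} :=
    (measurableSet_eq_fun (Φ.measurable_rule.comp
      (measurable_fst.prodMk (measurable_fst.comp measurable_snd)))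
      (measurable_snd.comp measurable_snd)).compl
  have key : M.law {z | M.bayes z.1 ≠ z.2} +
      ∑ i, ENNReal.ofReal (2 * t i) * B.meanMiss ht ht' Φ σ i ≤
      (P.prod M.law) {z | Φ.rule z.1 z.2.1 ≠ z.2.2} := by
    rw [Measure.prod_apply hset]
    calc M.law {z | M.bayes z.1 ≠ z.2} +
          ∑ i, ENNReal.ofReal (2 * t i) * B.meanMiss ht ht' Φ σ i
        = ∫⁻ S, (M.law {z | M.bayes z.1 ≠ z.2} +
            ∑ i, ENNReal.ofReal (2 * t i) * B.missMass Φ i (σ i) S) ∂P := by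
          rw [lintegral_add_left measurable_const, lintegral_const, measure_univ, mul_one,
            lintegral_finsetSum _ fun i _ => (B.measurable_missMass Φ i (σ i)).const_mul _]
          congr 1
          refine Finset.sum_congr rfl fun i _ => ?_
          rw [lintegral_const_mul _ (B.measurable_missMass Φ i (σ i))]
          rfl
      _ ≤ _ := lintegral_mono fun S => B.law_bayes_add_le ht ht' σ
          (Φ.measurable_rule.comp measurable_prodMk_left)
  have hfin (i : ι) : ENNReal.ofReal (2 * t i) * B.meanMiss ht ht' Φ σ i ≠ ⊤ :=
    ENNReal.mul_ne_top ENNReal.ofReal_ne_top (B.meanMiss_ne_top ht ht' Φ σ i)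
  have h := ENNReal.toReal_mono (measure_ne_top _ _) key
  rw [ENNReal.toReal_add (measure_ne_top _ _) (ENNReal.sum_ne_top.2 fun i _ => hfin i),
    ENNReal.toReal_sum fun i _ => hfin i] at h
  have e (i : ι) : (ENNReal.ofReal (2 * t i) * B.meanMiss ht ht' Φ σ i).toReal =
      2 * t i * (B.meanMiss ht ht' Φ σ i).toReal := by
    rw [ENNReal.toReal_mul, ENNReal.toReal_ofReal (by linarith [ht i])]
  simp_rw [e] at h
  rw [excessRisk, risk, Model.bayesRisk, Measure.real, Measure.real]
  linarith

/-- Flipping the sign on one ball changes the affinity by at most `4 t² w`. -/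
theorem one_le_affinity_add {b b' : ι → ℝ} (hb : ∀ i, |b i| ≤ 1 / 2) (hb' : ∀ i, |b' i| ≤ 1 / 2)
    {k : ι} (hk : b' k = -b k) (hne : ∀ i, i ≠ k → b' i = b i) :
    1 ≤ ∫⁻ z, (NNReal.sqrt ((B.model b hb).labelDensity z * (B.model b' hb').labelDensity z) :
        ℝ≥0∞) ∂(labelled B.marginal) + ENNReal.ofReal (4 * b k ^ 2 * B.weight k) := by
  set M := B.model b hb
  set M' := B.model b' hb'
  have hm : Measurable fun z => (NNReal.sqrt (M.labelDensity z * M'.labelDensity z) : ℝ≥0∞) :=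
    (NNReal.continuous_sqrt.measurable.comp
      (M.measurable_labelDensity.mul M'.measurable_labelDensity)).coe_nnreal_ennreal
  rw [lintegral_labelled _ hm, ENNReal.ofReal_mul (by positivity), ← B.marginal_ball k,
    ← setLIntegral_const, ← lintegral_indicator (B.measurableSet_ball k),
    ← lintegral_add_right _ (measurable_const.indicator (B.measurableSet_ball k))]
  calc (1 : ℝ≥0∞) = ∫⁻ _, 1 ∂B.marginal := by simp
    _ ≤ _ := lintegral_mono fun x => ?_
  by_cases hx : x ∈ B.ball k
  · rw [Set.indicator_of_mem hx]
    have h1 : M.regression x = 1 / 2 + b k := B.regression_of_mem _ hx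
    have h2 : M'.regression x = 1 / 2 - b k := by
      rw [sub_eq_add_neg, ← hk]; exact B.regression_of_mem _ hx
    have hbk := abs_le.1 (hb k)
    simp only [Model.labelDensity, if_true, Bool.false_eq_true, if_false, h1, h2]
    rw [← ENNReal.coe_add, ENNReal.ofReal, ← ENNReal.coe_add, ← ENNReal.coe_one,
      ENNReal.coe_le_coe, ← NNReal.coe_le_coe]
    push_cast
    rw [Real.coe_toNNReal _ (by linarith), Real.coe_toNNReal _ (by linarith),
      Real.coe_toNNReal _ (by linarith), Real.coe_toNNReal _ (by linarith),
      Real.coe_toNNReal _ (by positivity)]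
    have e1 : (1 / 2 + b k) * (1 / 2 - b k) = 1 / 4 - b k ^ 2 := by ring
    have e2 : (1 - (1 / 2 + b k)) * (1 - (1 / 2 - b k)) = 1 / 4 - b k ^ 2 := by ring
    rw [e1, e2]
    have h4 : 1 / 2 - 2 * b k ^ 2 ≤ √(1 / 4 - b k ^ 2) := by
      refine Real.le_sqrt_of_sq_le ?_
      nlinarith [sq_nonneg (b k), mul_nonneg (sub_nonneg.2 hbk.2) (neg_le_iff_add_nonneg.1 hbk.1)]
    linarith
  · have h : M'.regression x = M.regression x := by
      by_cases hx' : ∃ i, x ∈ B.ball i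
      · obtain ⟨i, hi⟩ := hx'
        have h1 : M.regression x = 1 / 2 + b i := B.regression_of_mem _ hi
        have h2 : M'.regression x = 1 / 2 + b' i := B.regression_of_mem _ hi
        rw [h1, h2, hne i fun h => hx (h ▸ hi)]
      · exact (B.regression_of_notMem _ (not_exists.1 hx')).trans
          (B.regression_of_notMem _ (not_exists.1 hx')).symm
    have hmem := M.regression_mem x
    refine le_trans (le_of_eq ?_) le_self_add
    simp only [Model.labelDensity, if_true, Bool.false_eq_true, if_false, h, NNReal.sqrt_mul_self]
    rw [← ENNReal.coe_add, ← Real.toNNReal_add hmem.1 (by linarith [hmem.2])]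
    simp

/-- No classifier tells the two signs on one ball apart if `n t² w` is small. -/
theorem weight_le_meanMiss_add [DecidableEq ι] {t : ι → ℝ} (ht : ∀ i, 0 ≤ t i)
    (ht' : ∀ i, t i ≤ 1 / 2) {n : ℕ} (Φ : Classifier d n) (σ : ι → Bool) (k : ι)
    (hk : 16 * n * t k ^ 2 * B.weight k ≤ 1) :
    B.weight k / 4 ≤ (B.meanMiss ht ht' Φ σ k).toReal +
      (B.meanMiss ht ht' Φ (Function.update σ k (!σ k)) k).toReal := by
  set σ' := Function.update σ k (!σ k) with hσ'
  have hσk : σ' k = !σ k := Function.update_self _ _ _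
  set M := B.model (signed t σ) (abs_signed_le ht ht' σ) with hM
  set M' := B.model (signed t σ') (abs_signed_le ht ht' σ') with hM'
  have haff := B.one_le_affinity_add (abs_signed_le ht ht' σ) (abs_signed_le ht ht' σ') (k := k)
    (by simp only [signed, hσk]; cases σ k <;> simp)
    (fun i hi => by simp only [signed, hσ', Function.update_of_ne hi])
  rw [← sq_abs, abs_signed ht] at haff
  set ρ := ∫⁻ z, (NNReal.sqrt (M.labelDensity z * M'.labelDensity z) : ℝ≥0∞)
    ∂(labelled B.marginal) with hρ
  set q := 4 * t k ^ 2 * B.weight k with hq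
  have hw := B.weight_pos k
  have hq0 : 0 ≤ q := by positivity
  have hρq : ENNReal.ofReal (1 - q) ≤ ρ := by
    rw [ENNReal.ofReal_sub _ hq0, ENNReal.ofReal_one]
    exact tsub_le_iff_right.2 haff
  have hnq : n * q ≤ 1 / 4 := by rw [hq]; linarith
  have hpow : ENNReal.ofReal (3 / 4) ≤ ρ ^ n := by
    rcases Nat.eq_zero_or_pos n with hn | hn
    · subst hn
      rw [pow_zero]
      exact ENNReal.ofReal_le_one.2 (by norm_num)
    · have hn1 : (1 : ℝ) ≤ n := by exact_mod_cast hn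
      have hq1 : q ≤ 1 / 4 := by nlinarith
      calc ENNReal.ofReal (3 / 4) ≤ ENNReal.ofReal ((1 - q) ^ n) := by
            refine ENNReal.ofReal_le_ofReal ?_
            have := one_add_mul_le_pow (a := -q) (by linarith) n
            rw [← sub_eq_add_neg] at this
            linarith
        _ = ENNReal.ofReal (1 - q) ^ n := ENNReal.ofReal_pow (by linarith) n
        _ ≤ ρ ^ n := by gcongr
  have hlaw := M.law_eq_withDensity
  have hlaw' := M'.law_eq_withDensity
  have i1 : IsProbabilityMeasure ((labelled B.marginal).withDensity
      fun z => (M.labelDensity z : ℝ≥0∞)) := by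
    change IsProbabilityMeasure ((labelled M.marginal).withDensity _)
    rw [← hlaw]; infer_instance
  have i2 : IsProbabilityMeasure ((labelled B.marginal).withDensity
      fun z => (M'.labelDensity z : ℝ≥0∞)) := by
    change IsProbabilityMeasure ((labelled M'.marginal).withDensity _)
    rw [← hlaw']; infer_instance
  have key := affinity_pow_le (labelled B.marginal) M.measurable_labelDensity
    M'.measurable_labelDensity (B.measurable_missMass Φ k (σ k))
    (B.measurable_missMass Φ k (!σ k)) (B.marginal_ball_le_missMass_add Φ k (σ k))
  have e1 : B.meanMiss ht ht' Φ σ k = ∫⁻ S, B.missMass Φ k (σ k) S ∂(Measure.pi fun _ : Fin n =>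
      (labelled B.marginal).withDensity fun z => (M.labelDensity z : ℝ≥0∞)) := by
    rw [meanMiss, ← hM, hlaw]; rfl
  have e2 : B.meanMiss ht ht' Φ σ' k = ∫⁻ S, B.missMass Φ k (!σ k) S
      ∂(Measure.pi fun _ : Fin n =>
        (labelled B.marginal).withDensity fun z => (M'.labelDensity z : ℝ≥0∞)) := by
    rw [meanMiss, ← hM', hlaw', hσk]; rfl
  rw [← e1, ← e2, ← hρ] at key
  have h := (mul_le_mul_right hpow (ENNReal.ofReal (B.weight k))).trans key
  have hf1 := B.meanMiss_ne_top ht ht' Φ σ k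
  have hf2 := B.meanMiss_ne_top ht ht' Φ σ' k
  have hf3 : ENNReal.ofReal (B.weight k) / 2 ≠ ⊤ := ENNReal.div_ne_top (by simp) (by simp)
  have h := ENNReal.toReal_mono (by simp [hf1, hf2, hf3]) h
  rw [ENNReal.toReal_add (by simp [hf1, hf2]) hf3, ENNReal.toReal_add hf1 hf2,
    ENNReal.toReal_mul, ENNReal.toReal_div, ENNReal.toReal_ofReal hw.le,
    ENNReal.toReal_ofReal (by norm_num)] at h
  simp only [ENNReal.toReal_ofNat] at h
  linarith

/-- Assouad's argument: averaging over all sign patterns, every ball contributes a fixed proportion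
of `t i * weight i` to the excess risk of any classifier. -/
theorem exists_le_excessRisk {t : ι → ℝ} (ht : ∀ i, 0 ≤ t i) (ht' : ∀ i, t i ≤ 1 / 2) {n : ℕ}
    (hn : ∀ i, 16 * n * t i ^ 2 * B.weight i ≤ 1) (Φ : Classifier d n) :
    ∃ σ : ι → Bool, (∑ i, t i * B.weight i) / 4 ≤
      excessRisk (B.model (signed t σ) (abs_signed_le ht ht' σ)) Φ := by
  classical
  obtain ⟨σ, -, hσ⟩ : ∃ σ ∈ (Finset.univ : Finset (ι → Bool)), (∑ i, t i * B.weight i) / 4 ≤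
      ∑ i, 2 * t i * (B.meanMiss ht ht' Φ σ i).toReal := by
    refine Finset.exists_le_of_sum_le Finset.univ_nonempty ?_
    rw [Finset.sum_comm, Finset.sum_const]
    -- Flipping the sign at `i` permutes the sign patterns, so each pattern can be paired with its
    -- flip.
    have hflip (i : ι) : Function.Involutive fun σ : ι → Bool => Function.update σ i (!σ i) :=
      fun σ => by simp
    have hi (i : ι) : (Finset.univ : Finset (ι → Bool)).card * (t i * B.weight i / 4) ≤
        ∑ σ : ι → Bool, 2 * t i * (B.meanMiss ht ht' Φ σ i).toReal := by
      have h1 : ∑ σ : ι → Bool, (B.meanMiss ht ht' Φ (Function.update σ i (!σ i)) i).toReal =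
          ∑ σ : ι → Bool, (B.meanMiss ht ht' Φ σ i).toReal :=
        Equiv.sum_comp (hflip i).toPerm fun σ => (B.meanMiss ht ht' Φ σ i).toReal
      have h2 : ∑ _σ : ι → Bool, B.weight i / 4 ≤ ∑ σ : ι → Bool,
          ((B.meanMiss ht ht' Φ σ i).toReal +
            (B.meanMiss ht ht' Φ (Function.update σ i (!σ i)) i).toReal) :=
        Finset.sum_le_sum fun σ _ => B.weight_le_meanMiss_add ht ht' Φ σ i (hn i)
      rw [Finset.sum_add_distrib, h1, Finset.sum_const, nsmul_eq_mul] at h2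
      rw [← Finset.mul_sum]
      have := mul_le_mul_of_nonneg_left h2 (ht i)
      linarith
    rw [nsmul_eq_mul, Finset.sum_div, Finset.mul_sum]
    exact Finset.sum_le_sum fun i _ => hi i
  exact ⟨σ, hσ.trans (B.sum_meanMiss_le_excessRisk ht ht' Φ σ)⟩

end BallMixture

/-! ### The grid of small balls -/

/-- The side length of the cube that holds the grid, so small that the balls have total volume at
most one. -/
noncomputable def side (d : ℕ) : ℝ := min 1 (1 / (2 * unitVolume d))

theorem side_pos (d : ℕ) : 0 < side d := by
  have := unitVolume_pos d
  unfold side; positivity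

theorem side_le_one (d : ℕ) : side d ≤ 1 := min_le_left _ _

theorem unitVolume_mul_side_pow_le (hd : 1 ≤ d) : unitVolume d * side d ^ d ≤ 1 / 2 := by
  have hu := unitVolume_pos d
  calc unitVolume d * side d ^ d ≤ unitVolume d * side d := by
        gcongr
        exact pow_le_of_le_one (side_pos d).le (side_le_one d) (by omega)
    _ ≤ unitVolume d * (1 / (2 * unitVolume d)) := by gcongr; exact min_le_right _ _
    _ = 1 / 2 := by field_simp

theorem norm_le_mul_of_forall_abs_le {v : E d} {m : ℝ} (hm : 0 ≤ m) (hv : ∀ i, |v i| ≤ m) :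
    ‖v‖ ≤ d * m := by
  refine abs_le_of_sq_le_sq' ?_ (by positivity) |>.2
  rw [EuclideanSpace.norm_sq_eq]
  calc ∑ i, ‖v i‖ ^ 2 ≤ ∑ _i : Fin d, m ^ 2 :=
        Finset.sum_le_sum fun i _ => pow_le_pow_left₀ (norm_nonneg _) (hv i) 2
    _ = d * m ^ 2 := by simp
    _ ≤ (d * m) ^ 2 := by
        have : (d : ℝ) ≤ (d : ℝ) ^ 2 := by exact_mod_cast Nat.le_self_pow two_ne_zero d
        rw [mul_pow]
        gcongr

/-- The centre of the cell with index `k` in the grid of mesh `side d / N`. -/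
noncomputable def gridCenter (d N : ℕ) (k : Fin d → Fin N) : E d :=
  WithLp.toLp 2 fun i => side d / N * ((k i : ℝ) + 1 / 2)

/-- A main ball of mass `1 - q` and, far from it, a grid of `N ^ d` small balls that share the mass
`q` equally. -/
noncomputable def gridMixture (hd : 1 ≤ d) {N : ℕ} (hN : 0 < N) {q : ℝ} (hq : 0 < q)
    (hq1 : q < 1) : BallMixture d (Option (Fin d → Fin N)) where
  center o := o.elim (WithLp.toLp 2 fun _ => -3) (gridCenter d N)
  radius o := o.elim (side d) fun _ => side d / (4 * N)
  radius_pos o := by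
    have := side_pos d
    cases o <;> simp only [Option.elim] <;> positivity
  weight o := o.elim (1 - q) fun _ => q / N ^ d
  weight_pos o := by
    cases o <;> simp only [Option.elim]
    · linarith
    · positivity
  sum_weight := by
    rw [Fintype.sum_option]
    simp only [Option.elim, Finset.sum_const, Finset.card_univ, Fintype.card_fun, Fintype.card_fin,
      nsmul_eq_mul]
    push_cast
    field_simp
    ring
  gap := side d / (2 * N)
  gap_pos := by have := side_pos d; positivity
  separated := by
    have hs := side_pos d
    have hs1 := side_le_one d
    have hN1 : (1 : ℝ) ≤ N := by exact_mod_cast hN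
    have hfar (k : Fin d → Fin N) : side d + side d / (4 * N) + side d / (2 * N) ≤
        ‖gridCenter d N k - WithLp.toLp 2 fun _ => (-3 : ℝ)‖ := by
      refine le_trans ?_ (PiLp.norm_apply_le _ (⟨0, hd⟩ : Fin d))
      have h1 : side d / (4 * N) ≤ side d := div_le_self hs.le (by linarith)
      have h2 : side d / (2 * N) ≤ side d := div_le_self hs.le (by linarith)
      have h3 : 0 ≤ side d / N * ((k ⟨0, hd⟩ : ℝ) + 1 / 2) := by positivity
      simp only [gridCenter, PiLp.sub_apply, Real.norm_eq_abs]
      rw [abs_of_nonneg (by linarith)]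
      linarith
    rintro (_ | k) (_ | l) hkl <;> simp only [Option.elim]
    · exact absurd rfl hkl
    · rw [norm_sub_rev]
      exact hfar l
    · rw [add_comm (side d / (4 * N))]
      exact hfar k
    · obtain ⟨i, hi⟩ := Function.ne_iff.1 fun h : k = l => hkl (congrArg some h)
      refine le_trans ?_ (PiLp.norm_apply_le _ i)
      have h1 : (1 : ℝ) ≤ |(k i : ℝ) - l i| := by
        have : (1 : ℤ) ≤ |(k i : ℤ) - l i| :=
          Int.one_le_abs (sub_ne_zero.2 fun h => hi (Fin.ext (by exact_mod_cast h)))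
        exact_mod_cast this
      have e : (gridCenter d N k - gridCenter d N l) i = side d / N * ((k i : ℝ) - l i) := by
        simp only [gridCenter, PiLp.sub_apply]; ring
      rw [e, norm_mul, Real.norm_of_nonneg (by positivity), Real.norm_eq_abs]
      calc side d / (4 * N) + side d / (4 * N) + side d / (2 * N) = side d / N * 1 := by
            field_simp; norm_num
        _ ≤ _ := by gcongr

/-- The minimal mass constant that holds uniformly over the grids. -/
noncomputable def gridConst (d : ℕ) : ℝ := profileConst d / (4 * d) ^ d

theorem gridConst_pos (hd : 1 ≤ d) : 0 < gridConst d := by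
  have := profileConst_pos d
  unfold gridConst; positivity

/-- A block of `J ^ d` cells of the grid around the cell `k`, shifted inwards if `k` is near the
boundary of the grid. -/
theorem exists_block {N J : ℕ} (hJ : 1 ≤ J) (hJN : J ≤ N) (k : Fin d → Fin N) :
    ∃ s : Finset (Fin d → Fin N), s.card = J ^ d ∧
      ∀ l ∈ s, ∀ i, |(l i : ℝ) - k i| ≤ J - 1 := by
  classical
  -- In each coordinate, the `J` consecutive indices from `min (k i) (N - J)` on contain `k i`.
  let f (j : Fin d → Fin J) (i : Fin d) : Fin N := ⟨min (k i : ℕ) (N - J) + j i, by omega⟩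
  have hf : Function.Injective f := fun j j' h => by
    ext i
    have := congrArg Fin.val (congrFun h i)
    simpa [f] using this
  refine ⟨Finset.univ.image f, by simp [Finset.card_image_of_injective _ hf], fun l hl i => ?_⟩
  obtain ⟨j, -, rfl⟩ := Finset.mem_image.1 hl
  have h1 : ((f j i : ℕ) : ℤ) - (k i : ℕ) ≤ J - 1 := by simp only [f]; omega
  have h2 : -((J : ℤ) - 1) ≤ ((f j i : ℕ) : ℤ) - (k i : ℕ) := by simp only [f]; omega
  rw [abs_le]
  exact ⟨by exact_mod_cast h2, by exact_mod_cast h1⟩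

/-- At scales below the mesh the ball of the point itself suffices; above the mesh a block of cells
fits in the ball, and their number grows like `δ ^ d`. -/
theorem gridMixture_mem_minimalMassUpTo (hd : 1 ≤ d) {N : ℕ} (hN : 0 < N) {q : ℝ} (hq : 0 < q)
    (hq1 : q < 1) {b : Option (Fin d → Fin N) → ℝ} (hb : ∀ i, |b i| ≤ 1 / 2) :
    (gridMixture hd hN hq hq1).model b hb ∈ minimalMassUpTo d (gridConst d) (side d) := by
  set B := gridMixture hd hN hq hq1 with hB
  intro δ hδ hδs x hx
  change gridConst d * B.density x * δ ^ d ≤ B.marginal.real _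
  have hs := side_pos d
  have hκ := profileConst_pos d
  have hdpos : (1 : ℝ) ≤ d := by exact_mod_cast hd
  have hNpos : (1 : ℝ) ≤ N := by exact_mod_cast hN
  have hx0 := B.density_nonneg x
  have hlocal {i : Option (Fin d → Fin N)} (hi : x ∈ B.ball i) {r : ℝ} (hr : 0 < r)
      (hri : r ≤ 2 * B.radius i) (hrδ : r ≤ δ) (hδr : δ / (4 * d) ≤ r) :
      gridConst d * B.density x * δ ^ d ≤ B.marginal.real (Metric.ball x δ) := by
    calc gridConst d * B.density x * δ ^ d
        = profileConst d * B.density x * (δ / (4 * d)) ^ d := by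
          rw [gridConst, div_pow]; ring
      _ ≤ profileConst d * B.density x * r ^ d := by gcongr
      _ ≤ B.marginal.real (Metric.ball x r) := B.profileConst_mul_density_le hi hr hri
      _ ≤ _ := measureReal_mono (Metric.ball_subset_ball hrδ) (measure_ne_top _ _)
  obtain ⟨i, hi⟩ := B.exists_mem_of_density_pos hx
  rcases i with _ | k
  · refine hlocal hi hδ ?_ le_rfl (div_le_self hδ.le (by linarith))
    change δ ≤ 2 * side d
    linarith
  set s := side d / N with hsdef
  have hs0 : 0 < s := by positivity
  have hrad : B.radius (some k) = s / 4 := by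
    change side d / (4 * N) = _
    rw [hsdef]; field_simp
  -- Below `d` times the mesh, a radius of at most the diameter of the cell loses only a factor.
  rcases le_or_gt δ (d * s) with h | h
  · refine hlocal hi (r := min δ (s / 2)) (by positivity) ?_ (min_le_left _ _) ?_
    · rw [hrad]; linarith [min_le_right δ (s / 2)]
    · refine le_min (div_le_self hδ.le (by linarith)) ?_
      rw [div_le_iff₀ (by positivity)]
      nlinarith
  · have hds : 0 < d * s := by positivity
    set J := ⌊δ / (d * s)⌋₊ with hJ
    have hy1 : 1 ≤ δ / (d * s) := (one_le_div hds).2 h.le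
    have hJ1 : 1 ≤ J := Nat.one_le_floor_iff _ |>.2 hy1
    have hJ1' : (1 : ℝ) ≤ J := by exact_mod_cast hJ1
    have hJle : J * (d * s) ≤ δ := by
      rw [← le_div_iff₀ hds]; exact Nat.floor_le (by positivity)
    have hJge : δ ≤ 2 * J * (d * s) := by
      rw [← div_le_iff₀ hds]
      have := Nat.lt_floor_add_one (δ / (d * s))
      rw [← hJ] at this
      linarith
    have hJN : J ≤ N := by
      have h1 : J * s ≤ N * s := by
        have e : N * s = side d := by rw [hsdef]; field_simp
        rw [e]
        refine le_trans ?_ (hJle.trans hδs)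
        nlinarith [mul_pos (lt_of_lt_of_le one_pos hJ1') hs0]
      exact_mod_cast le_of_mul_le_mul_right h1 hs0
    obtain ⟨S, hScard, hS⟩ := exists_block hJ1 hJN k
    have hsub : ∀ o ∈ S.map Function.Embedding.some, B.ball o ⊆ Metric.ball x δ := by
      intro o ho
      obtain ⟨l, hl, rfl⟩ := Finset.mem_map.1 ho
      intro z hz
      have hz' : ‖z - gridCenter d N l‖ < side d / (4 * N) := mem_ball_iff_norm.1 hz
      have hx' : ‖x - gridCenter d N k‖ < side d / (4 * N) := mem_ball_iff_norm.1 hi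
      have e4 : side d / (4 * N) = s / 4 := by rw [hsdef]; field_simp
      rw [e4] at hz' hx'
      have hc : ‖gridCenter d N l - gridCenter d N k‖ ≤ d * (s * (J - 1)) := by
        refine norm_le_mul_of_forall_abs_le (mul_nonneg hs0.le (by linarith)) fun i => ?_
        have e : (gridCenter d N l - gridCenter d N k) i = s * ((l i : ℝ) - k i) := by
          simp only [gridCenter, PiLp.sub_apply, hsdef]; ring
        rw [e, abs_mul, abs_of_pos hs0]
        exact mul_le_mul_of_nonneg_left (hS l hl i) hs0.le
      rw [mem_ball_iff_norm]
      have e : z - x = (z - gridCenter d N l) + (gridCenter d N l - gridCenter d N k) +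
          -(x - gridCenter d N k) := by abel
      have h3 : ‖z - x‖ ≤ ‖z - gridCenter d N l‖ + ‖gridCenter d N l - gridCenter d N k‖ +
          ‖x - gridCenter d N k‖ := by
        rw [e, ← norm_neg (x - gridCenter d N k)]
        exact norm_add₃_le
      nlinarith
    have hsum := B.sum_weight_le _ hsub
    have hw : B.height (some k) * (profileConst d * (s / 2) ^ d) ≤ q / N ^ d := by
      have h1 := profileConst_le_integral (B.center (some k)) (B.radius_pos (some k))
      have h2 : B.height (some k) * ∫ z, profile (B.center (some k)) (B.radius (some k)) z =
          q / N ^ d := div_mul_cancel₀ _ (integral_profile_pos _ (B.radius_pos (some k))).ne'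
      rw [← h2]
      have e : s / 2 = 2 * B.radius (some k) := by rw [hrad]; ring
      rw [e]
      exact mul_le_mul_of_nonneg_left h1 (B.height_pos _).le
    have hh := B.height_pos (some k)
    rw [Finset.sum_map] at hsum
    refine le_trans ?_ hsum
    have e : ∑ l ∈ S, B.weight (Function.Embedding.some l) = J ^ d * (q / N ^ d) := by
      change ∑ l ∈ S, q / (N : ℝ) ^ d = _
      rw [Finset.sum_const, hScard, nsmul_eq_mul]
      push_cast
      rfl
    rw [e, B.density_of_mem hi]
    calc gridConst d * (B.height (some k) * profile (B.center (some k)) (B.radius (some k)) x) *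
          δ ^ d
        ≤ gridConst d * (B.height (some k) * 1) * δ ^ d := by
          have := (gridConst_pos hd).le
          gcongr
          exact profile_le_one _ _ _
      _ = B.height (some k) * profileConst d * (δ / (4 * d)) ^ d := by
          rw [gridConst, div_pow]; ring
      _ ≤ B.height (some k) * profileConst d * (J * (s / 2)) ^ d := by
          gcongr
          rw [div_le_iff₀ (by positivity)]
          linarith
      _ = J ^ d * (B.height (some k) * (profileConst d * (s / 2) ^ d)) := by
          rw [mul_pow]; ring
      _ ≤ J ^ d * (q / N ^ d) := by gcongr

theorem gridMixture_sum_volume_le (hd : 1 ≤ d) {N : ℕ} (hN : 0 < N) {q : ℝ} (hq : 0 < q)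
    (hq1 : q < 1) :
    ∑ i, unitVolume d * (gridMixture hd hN hq hq1).radius i ^ d ≤ 1 := by
  have h := unitVolume_mul_side_pow_le hd
  have hu := unitVolume_pos d
  have hs := side_pos d
  rw [Fintype.sum_option]
  simp only [gridMixture, Option.elim, Finset.sum_const, Finset.card_univ, Fintype.card_fun,
    Fintype.card_fin, nsmul_eq_mul]
  have h2 : (((N ^ d : ℕ) : ℝ) * (unitVolume d * (side d / (4 * N)) ^ d)) ≤
      unitVolume d * side d ^ d := by
    have e : ((N ^ d : ℕ) : ℝ) * (unitVolume d * (side d / (4 * N)) ^ d) =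
        unitVolume d * (side d / 4) ^ d := by
      push_cast
      rw [mul_left_comm, ← mul_pow]
      congr 2
      field_simp
    rw [e]
    gcongr
    linarith
  linarith

/-! ### The minimax lower bound -/

/-- The grid of mesh of order `n ^ (-1 / (2 + α + d))` with total mass `q` of order `N ^ (-α)` in the
small balls and amplitude of order `1 / N` defeats every classifier based on `n` observations. -/
theorem exists_model_le_excessRisk (hd : 1 ≤ d) {L α C : ℝ} (hL : 0 < L) (hα : 0 < α)
    (hC : 0 < C) :
    ∃ c : ℝ, 0 < c ∧ ∀ n : ℕ, 1 ≤ n → ∀ Φ : Classifier d n, ∃ M : Model d,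
      M ∈ smoothMargin d L α C ∧ M ∈ minimalMassUpTo d (gridConst d) (side d) ∧
      (∀ κ, κ < unitVolume d → M ∈ minimalMass d κ) ∧ (∀ ε₀, M ∈ tail d id ε₀) ∧
      c * (n : ℝ) ^ (-((1 + α) / (2 + α + (d : ℝ)))) ≤ excessRisk M Φ := by
  have hs := side_pos d
  -- The amplitude `a / N` is limited by the Lipschitz constant over the gap `side d / (2 N)`.
  set a := min (1 / 4) (L * side d / 4) with ha
  have ha0 : 0 < a := by positivity
  have ha1 : a ≤ 1 / 4 := min_le_left _ _
  have ha2 : a ≤ L * side d / 4 := min_le_right _ _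
  -- The mass `m / N ^ α` of the small balls is limited by the margin condition.
  set m := min (1 / 2) (C * a ^ α) with hm
  have hm0 : 0 < m := by positivity
  have hm1 : m ≤ 1 / 2 := min_le_left _ _
  have hm2 : m ≤ C * a ^ α := min_le_right _ _
  refine ⟨a * m / 4 * 2 ^ (-(1 + α)), by positivity, fun n hn Φ => ?_⟩
  have hn1 : (1 : ℝ) ≤ n := by exact_mod_cast hn
  have hn0 : (0 : ℝ) < n := by linarith
  set e := 2 + α + (d : ℝ) with he
  have he0 : 0 < e := by positivity
  have hy1 : (1 : ℝ) ≤ (n : ℝ) ^ (1 / e) := Real.one_le_rpow hn1 (by positivity)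
  -- The least `N` with `n ≤ N ^ (2 + α + d)`: the sample does not reveal the sign of any ball.
  set N := ⌈(n : ℝ) ^ (1 / e)⌉₊ with hNdef
  have hNge : (n : ℝ) ^ (1 / e) ≤ N := Nat.le_ceil _
  have hNle : (N : ℝ) ≤ 2 * (n : ℝ) ^ (1 / e) := by
    have := Nat.ceil_lt_add_one (zero_le_one.trans hy1)
    rw [← hNdef] at this
    linarith
  have hN1 : (1 : ℝ) ≤ N := hy1.trans hNge
  have hN0 : (0 : ℝ) < N := by linarith
  have hN : 0 < N := by exact_mod_cast hN0
  have hNe : (n : ℝ) ≤ N ^ 2 * (N : ℝ) ^ α * N ^ d := by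
    calc (n : ℝ) = ((n : ℝ) ^ (1 / e)) ^ e := by
          rw [← Real.rpow_mul hn0.le, one_div_mul_cancel he0.ne', Real.rpow_one]
      _ ≤ (N : ℝ) ^ e := by gcongr
      _ = _ := by
          rw [he, Real.rpow_add hN0, Real.rpow_add hN0, Real.rpow_natCast]
          norm_num
  set q := m / (N : ℝ) ^ α with hq
  have hNα : 1 ≤ (N : ℝ) ^ α := Real.one_le_rpow hN1 hα.le
  have hq0 : 0 < q := by positivity
  have hq1 : q < 1 := (div_le_self hm0.le hNα).trans_lt (by linarith)
  set B := gridMixture hd hN hq0 hq1 with hB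
  let t (o : Option (Fin d → Fin N)) : ℝ := o.elim 0 fun _ => a / N
  have haN : a / N ≤ a := div_le_self ha0.le hN1
  have haN0 : 0 < a / N := by positivity
  have ht (o) : 0 ≤ t o := by cases o <;> simp only [t, Option.elim] <;> positivity
  have htle (o) : t o ≤ a / N := by
    cases o <;> simp only [t, Option.elim]
    · positivity
    · exact le_rfl
  have ht' (o) : t o ≤ 1 / 2 := (htle o).trans (by linarith)
  have hcell : ∀ k : Fin d → Fin N, B.weight (some k) = q / N ^ d := fun _ => rfl
  have hweights : ∑ k : Fin d → Fin N, B.weight (some k) = q := by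
    simp only [hcell, Finset.sum_const, Finset.card_univ, Fintype.card_fun, Fintype.card_fin,
      nsmul_eq_mul]
    push_cast
    field_simp
  have hsmall (o) : 16 * n * t o ^ 2 * B.weight o ≤ 1 := by
    cases o with
    | none => simp [t]
    | some k =>
      rw [hcell]
      change 16 * n * (a / N) ^ 2 * (m / (N : ℝ) ^ α / N ^ d) ≤ 1
      have h1 : 16 * a ^ 2 * m ≤ 1 := by nlinarith
      calc 16 * n * (a / N) ^ 2 * (m / (N : ℝ) ^ α / N ^ d)
          = 16 * a ^ 2 * m * (n / (N ^ 2 * (N : ℝ) ^ α * N ^ d)) := by field_simp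
        _ ≤ 1 * 1 := by
            gcongr
            exact (div_le_one (by positivity)).2 hNe
        _ = 1 := one_mul 1
  obtain ⟨σ, hσ⟩ := B.exists_le_excessRisk ht ht' (n := n) hsmall Φ
  refine ⟨_, B.mem_smoothMargin (BallMixture.abs_signed_le ht ht' σ) hL hα hC haN0 (fun i j => ?_)
    (fun o => ?_) (s := Finset.univ.map Function.Embedding.some) (fun o ho => ?_) ?_,
    gridMixture_mem_minimalMassUpTo hd hN hq0 hq1 _, fun κ hκ => B.mem_minimalMass _ hκ,
    fun ε₀ => B.mem_tail _ (gridMixture_sum_volume_le hd hN hq0 hq1) ε₀, le_trans ?_ hσ⟩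
  · have h1 := (BallMixture.abs_signed ht σ i).trans_le (htle i)
    have h2 := (BallMixture.abs_signed ht σ j).trans_le (htle j)
    refine (abs_sub _ _).trans ?_
    change _ ≤ L * (side d / (2 * N))
    calc _ ≤ 2 * (L * side d / 4 / N) := by
          have : a / N ≤ L * side d / 4 / N := by gcongr
          linarith
      _ = _ := by field_simp; norm_num
  · cases o with
    | none => exact Or.inl (by simp [BallMixture.signed, t])
    | some k => exact Or.inr (BallMixture.abs_signed ht σ _)
  · cases o with
    | none => simp [BallMixture.signed, t]
    | some k => simp at ho
  · rw [Finset.sum_map]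
    refine hweights.trans_le ?_
    rw [Real.div_rpow ha0.le hN0.le, hq, ← mul_div_assoc]
    gcongr
  · have hsum : ∑ o, t o * B.weight o = a / N * q := by
      rw [Fintype.sum_option, ← hweights, Finset.mul_sum]
      simp [t]
    rw [hsum]
    have h1 : (2 * (n : ℝ) ^ (1 / e)) ^ (-(1 + α)) ≤ (N : ℝ) ^ (-(1 + α)) :=
      Real.rpow_le_rpow_of_nonpos hN0 hNle (by linarith)
    rw [Real.mul_rpow (by norm_num) (by positivity), ← Real.rpow_mul hn0.le] at h1
    have e1 : 1 / e * -(1 + α) = -((1 + α) / e) := by ring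
    have e2 : a / N * q / 4 = a * m / 4 * (N : ℝ) ^ (-(1 + α)) := by
      rw [Real.rpow_neg hN0.le, Real.rpow_add hN0, Real.rpow_one, hq]
      field_simp
    rw [e2, mul_assoc, ← e1]
    gcongr

theorem le_minimaxRisk {n : ℕ} {F : Set (Model d)} {r : ℝ}
    (h : ∀ Φ : Classifier d n, ∃ M ∈ F, r ≤ excessRisk M Φ) : (r : EReal) ≤ minimaxRisk n F := by
  refine le_iInf fun Φ => ?_
  obtain ⟨M, hM, hr⟩ := h Φ
  exact le_iSup₂_of_le M hM (EReal.coe_le_coe_iff.2 hr)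

end BinaryClassification

theorem mainTheorem3 (d : ℕ) (hd : 1 ≤ d) :
    (∀ L α C κ ε₀ : ℝ, 0 < L → 0 < α → 0 < C → 0 < ε₀ → 0 < κ →
      κ < volume.real (Metric.ball (0 : BinaryClassification.E d) 1) →
      ∃ c : ℝ, 0 < c ∧ ∀ n : ℕ, 1 ≤ n →
        ((c * (n : ℝ) ^ (-((1 + α) / (2 + α + (d : ℝ)))) : ℝ) : EReal) ≤
          BinaryClassification.minimaxRisk n
            (BinaryClassification.smoothMargin d L α C ∩ BinaryClassification.minimalMass d κ ∩
              BinaryClassification.tail d id ε₀)) ∧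
    (∃ κ₀ δ₀ : ℝ, 0 < κ₀ ∧ 0 < δ₀ ∧
      ∀ L α C ε₀ : ℝ, 0 < L → 0 < α → 0 < C → 0 < ε₀ →
      ∃ c : ℝ, 0 < c ∧ ∀ n : ℕ, 1 ≤ n →
        ((c * (n : ℝ) ^ (-((1 + α) / (2 + α + (d : ℝ)))) : ℝ) : EReal) ≤
          BinaryClassification.minimaxRisk n
            (BinaryClassification.smoothMargin d L α C ∩
              BinaryClassification.minimalMassUpTo d κ₀ δ₀ ∩
              BinaryClassification.tail d id ε₀)) := by
  refine ⟨fun L α C κ ε₀ hL hα hC _ _ hκ => ?_, BinaryClassification.gridConst d,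
    BinaryClassification.side d, BinaryClassification.gridConst_pos hd,
    BinaryClassification.side_pos d, fun L α C ε₀ hL hα hC _ => ?_⟩
  · obtain ⟨c, hc, h⟩ := BinaryClassification.exists_model_le_excessRisk hd hL hα hC
    refine ⟨c, hc, fun n hn => BinaryClassification.le_minimaxRisk fun Φ => ?_⟩
    obtain ⟨M, h1, -, h3, h4, h5⟩ := h n hn Φ
    exact ⟨M, ⟨⟨h1, h3 κ hκ⟩, h4 ε₀⟩, h5⟩
  · obtain ⟨c, hc, h⟩ := BinaryClassification.exists_model_le_excessRisk hd hL hα hC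
    refine ⟨c, hc, fun n hn => BinaryClassification.le_minimaxRisk fun Φ => ?_⟩
    obtain ⟨M, h1, h2, -, h4, h5⟩ := h n hn Φ
    exact ⟨M, ⟨⟨h1, h2⟩, h4 ε₀⟩, h5⟩
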